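/- Let $G$ be a finite abelian group, $\chi:G\times G\to\{z\in\mathbb C:|z|=1\}$ a non-degenerate symmetric bicharacter and $\tau=\pm|G|^{-1/2}$. Put $\Omega=G\sqcup\{m\}$, $\Omega_g=\Omega$ for $g\in G$, and $\Omega_m=G\sqcup\overline G$, where $\overline G=\{\overline k: k\in G\}$ is a second copy of $G$. For $x\in\Omega$ let $H^x$ be the Hilbert space with orthonormal basis $(v^x_\alpha)_{\alpha\in\Omega_x}$, and $\overline{H^x}$ its conjugate. **The Tambara–Yamagami weak Hopf $C^*$-algebra.** Let $B=\bigoplus_{x\in\Omega}H^x\otimes\overline{H^x}$, with basis $f^x_{\alpha,\beta}=v^x_\alpha\otimes\overline{v^x_\beta}$ and product $f^x_{\alpha,\beta}f^y_{\gamma,\delta}=(v^x_\alpha\circ v^y_\gamma)\otimes\overline{(v^x_\beta\circ v^y_\delta)}$, where, for $g,h,k\in G$, $$v^g_k\circ v^h_x=\delta_{x,h+k}v^{g+h}_{h+k},\quad v^g_m\circ v^h_x=\delta_{x,m}v^{g+h}_m,\quad v^m_k\circ v^g_x=\delta_{x,m}\chi(g,k)v^m_k,\quad v^m_{\overline k}\circ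 v^g_x=\delta_{x,g+k}v^m_{\overline{g+k}},$$ $$v^g_x\circ v^m_{\overline k}=\delta_{x,m}\chi(g,k)v^m_{\overline k},\quad v^g_x\circ v^m_k=\delta_{x,k}v^m_{k-g},\quad v^m_h\circ v^m_{\overline k}=v^{k-h}_k,\quad v^m_{\overline h}\circ v^m_k=\delta_{h,k}\,\tau\sum_{g\in G}\chi(g,h)^{-1}v^g_m,$$ and $v^m_h\circ v^m_k=v^m_{\overline h}\circ v^m_{\overline k}=0$. The unit is $\sum_{\alpha,\beta\in\Omega}f^0_{\alpha,\beta}$. The coproduct and counit are $\Delta(f^x_{\alpha,\beta})=\sum_{\gamma\in\Omega_x}f^x_{\alpha,\gamma}\otimes f^x_{\gamma,\beta}$ and $\varepsilon(f^x_{\alpha,\beta})=\delta_{\alpha,\beta}$. With $m-g:=m$, the (linear) antipode and the (antilinear) involution are, for $g,h\in G$ and $\alpha,\beta\in\Omega$, $$S(f^g_{\alpha,\beta})=f^{-g}_{\beta-g,\alpha-g},\quad S(f^m_{g,h})=f^m_{\overline h,\overline g},\quad S(f^m_{g,\overline h})=\tau^{-1}f^m_{h,\overline g},\quad S(f^m_{\overline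 g,h})=\tau f^m_{\overline h,g},\quad S(f^m_{\overline g,\overline h})=f^m_{h,g},$$ $$(f^g_{\alpha,\beta})^*=f^{-g}_{\alpha-g,\beta-g},\quad (f^m_{g,h})^*=f^m_{\overline g,\overline h},\quad (f^m_{g,\overline h})^*=\tau f^m_{\overline g,h},\quad (f^m_{\overline g,h})^*=\tau^{-1}f^m_{g,\overline h},\quad (f^m_{\overline g,\overline h})^*=f^m_{g,h}.$$ This makes $B$ a weak Hopf $C^*$-algebra $\mathfrak G$. As a $C^*$-algebra, $B\cong\bigoplus_{x\in\Omega}B(H^x)$; with $e^x_{y,z}$ the matrix units of $B(H^x)$ ($y,z\in\Omega_x$), an isomorphism is given, for $g,h,k\in G$, by $$f^g_{h,k}=e^{h-k}_{g-k,-k},\quad f^g_{m,m}=\sum_{d\in G}\chi(g,d)\,e^d_{m,m},\quad f^g_{k,m}=e^m_{k-g,k},\quad f^g_{m,k}=e^m_{\overline{k-g},\overline k},$$ $$f^m_{h,k}=e^{h-k}_{-k,m},\quad f^m_{\overline h,\overline k}=e^{h-k}_{m,-k},\quad f^m_{h,\overline k}=\tau\chi(h,k)^{-1}e^m_{h,\overline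 k},\quad f^m_{\overline h,k}=\chi(h,k)\,e^m_{\overline k,h}.$$ **Quantum subgroupoids and coideals.** A quantum subgroupoid of $\mathfrak G$ is a weak Hopf $C^*$-algebra $\mathfrak H=(C,\Delta_C,S_C,\varepsilon_C)$ with a surjective unital $*$-homomorphism $\pi:B\to C$ compatible with coproducts, antipodes and counits. Its quotient type coideal is $$I(\mathfrak H\backslash\mathfrak G)=\{b\in B:\ (\pi\otimes\mathrm{id})\Delta(b)=(\pi\otimes\mathrm{id})((1\otimes b)\Delta(1))\}.$$ Let $B_s$ be the image of the source counital map $\varepsilon_s(b)=(\mathrm{id}\otimes\varepsilon)((1\otimes b)\Delta(1))$. Let $(\mathfrak G^\Omega,\pi_\Omega)=(\mathfrak G,\mathrm{id})$. For a subgroup $L$ of $G$, let $B_L=\bigoplus_{l\in L}B(H^l)$ with $$\Delta_L(e^l_{y,z})=\sum_{l_1,l_2\in L,\ l_1+l_2=l}e^{l_1}_{y-l_2,z-l_2}\otimes e^{l_2}_{y,z},\qquad S_L(e^l_{y,z})=e^{-l}_{z-l,y-l},\qquad \varepsilon_L(e^l_{y,z})=\delta_{l,0}\qquad(y,z\in\Omega),$$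 and let $\pi_L:B\to B_L$ be the canonical projection, $\pi_L(e^x_{y,z})=e^x_{y,z}$ if $x\in L$ and $0$ otherwise; this is a quantum subgroupoid $(\mathfrak G^L,\pi_L)$ of $\mathfrak G$. For $x=\Omega$ or $x$ a subgroup of $G$, put $I^x=I(\mathfrak G^x\backslash\mathfrak G)$. Put $L^\perp=\{g\in G:\chi(g,l)=1\ \text{for all } l\in L\}$ and, for a coset $Y\in G/L$, $v^0_Y=\sum_{y\in Y}v^0_y\in H^0$. **Proposition.** One has $I^\Omega=B_s$ and, for every subgroup $L$ of $G$, $$I^L=\operatorname{span}\{v^0_Y:\ Y\in G/L\}\otimes\overline{H^0}\ \oplus\ \bigoplus_{l\in L^\perp}v^l_m\otimes\overline{H^l}.$$ (The last sum includes $l=0$, which contributes $v^0_m\otimes\overline{H^0}$.) -/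

import Mathlib

open scoped TensorProduct

universe u

/-! ## Weak Hopf C*-algebras, morphisms, quantum subgroupoids -/

section WeakHopf

/-- The target counital map `ε_t(b) = (ε ⊗ id)(Δ(1)(b ⊗ 1))`. -/
noncomputable def targetCounital (B : Type u) [Ring B] [Algebra ℂ B] [Coalgebra ℂ B] :
    B →ₗ[ℂ] B where
  toFun b := TensorProduct.lid ℂ B
    (TensorProduct.map Coalgebra.counit LinearMap.id
      (Coalgebra.comul (R := ℂ) (1 : B) * (b ⊗ₜ[ℂ] (1 : B))))
  map_add' a b := by simp [TensorProduct.add_tmul, mul_add]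
  map_smul' c a := by simp [← TensorProduct.smul_tmul']

/-- The source counital map `ε_s(b) = (id ⊗ ε)((1 ⊗ b)Δ(1))`. -/
noncomputable def sourceCounital (B : Type u) [Ring B] [Algebra ℂ B] [Coalgebra ℂ B] :
    B →ₗ[ℂ] B where
  toFun b := TensorProduct.rid ℂ B
    (TensorProduct.map LinearMap.id Coalgebra.counit
      (((1 : B) ⊗ₜ[ℂ] b) * Coalgebra.comul (R := ℂ) (1 : B)))
  map_add' a b := by simp [TensorProduct.tmul_add, add_mul]
  map_smul' c a := by simp

/-- The source counital subalgebra `B_s`, the image of `ε_s`. -/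
noncomputable def sourceSubalgebra (B : Type u) [Ring B] [Algebra ℂ B] [Coalgebra ℂ B] :
    Submodule ℂ B :=
  LinearMap.range (sourceCounital B)

/-- A weak Hopf C*-algebra: a finite-dimensional C*-algebra (that is, a finite-dimensional
`*`-algebra with a faithful `*`-representation by matrices) which is also a coalgebra, with the
axioms of a weak bialgebra, an antipode, and a `*`-preserving comultiplication. -/
class WeakHopfCStarAlgebra (B : Type u) [Ring B] [Algebra ℂ B] [StarRing B] [StarModule ℂ B]
    [Coalgebra ℂ B] where
  finite : Module.Finite ℂ B
  exists_faithful : ∃ (n : ℕ) (φ : B →⋆ₐ[ℂ] Matrix (Fin n) (Fin n) ℂ), Function.Injective φ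
  comul_mul : ∀ b c : B, Coalgebra.comul (R := ℂ) (b * c) =
    Coalgebra.comul (R := ℂ) b * Coalgebra.comul (R := ℂ) c
  /-- `ε(b c₁) ε(c₂ d) = ε(b c d)` -/
  counit_mul : ∀ b c d : B,
    LinearMap.mul' ℂ ℂ (TensorProduct.map
      (Coalgebra.counit (R := ℂ) (A := B) ∘ₗ LinearMap.mulLeft ℂ b)
      (Coalgebra.counit (R := ℂ) (A := B) ∘ₗ LinearMap.mulRight ℂ d)
      (Coalgebra.comul (R := ℂ) c)) = Coalgebra.counit (R := ℂ) (b * c * d)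
  /-- `(Δ(1) ⊗ 1)(1 ⊗ Δ(1)) = (Δ ⊗ id)Δ(1)` -/
  comul_one :
    (Coalgebra.comul (R := ℂ) (1 : B) ⊗ₜ[ℂ] (1 : B)) *
      (TensorProduct.assoc ℂ B B B).symm ((1 : B) ⊗ₜ[ℂ] Coalgebra.comul (R := ℂ) (1 : B)) =
    TensorProduct.map Coalgebra.comul LinearMap.id (Coalgebra.comul (R := ℂ) (1 : B))
  antipode : B →ₗ[ℂ] B
  antipode_one : antipode 1 = 1
  antipode_mul : ∀ b c : B, antipode (b * c) = antipode c * antipode b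
  counit_antipode : ∀ b : B, Coalgebra.counit (R := ℂ) (antipode b) = Coalgebra.counit (R := ℂ) b
  comul_antipode : ∀ b : B, Coalgebra.comul (R := ℂ) (antipode b) =
    TensorProduct.map antipode antipode
      (TensorProduct.comm ℂ B B (Coalgebra.comul (R := ℂ) b))
  /-- `m(id ⊗ S)Δ(b) = ε_t(b)` -/
  mul_antipode_right : ∀ b : B, LinearMap.mul' ℂ B
    (TensorProduct.map LinearMap.id antipode (Coalgebra.comul (R := ℂ) b)) = targetCounital B b
  /-- `m(S ⊗ id)Δ(b) = ε_s(b)` -/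
  mul_antipode_left : ∀ b : B, LinearMap.mul' ℂ B
    (TensorProduct.map antipode LinearMap.id (Coalgebra.comul (R := ℂ) b)) = sourceCounital B b
  comul_star : ∀ b : B, Coalgebra.comul (R := ℂ) (star b) = star (Coalgebra.comul (R := ℂ) b)

/-- A morphism of weak Hopf C*-algebras: a unital `*`-homomorphism compatible with
the comultiplications, the antipodes and the counits. -/
structure WeakHopfHom (B : Type u) (C : Type u)
    [Ring B] [Algebra ℂ B] [StarRing B] [StarModule ℂ B] [Coalgebra ℂ B] [WeakHopfCStarAlgebra B]
    [Ring C] [Algebra ℂ C] [StarRing C] [StarModule ℂ C] [Coalgebra ℂ C] [WeakHopfCStarAlgebra C]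
    extends B →⋆ₐ[ℂ] C where
  map_comul : ∀ b : B, Coalgebra.comul (R := ℂ) (toStarAlgHom b) =
    TensorProduct.map toStarAlgHom.toAlgHom.toLinearMap toStarAlgHom.toAlgHom.toLinearMap
      (Coalgebra.comul (R := ℂ) b)
  map_antipode : ∀ b : B, WeakHopfCStarAlgebra.antipode (toStarAlgHom b) =
    toStarAlgHom (WeakHopfCStarAlgebra.antipode b)
  map_counit : ∀ b : B, Coalgebra.counit (R := ℂ) (toStarAlgHom b) = Coalgebra.counit (R := ℂ) b

/-- A quantum subgroupoid of `B`: a weak Hopf C*-algebra `C` with an epimorphism `π : B → C`. -/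
structure QuantumSubgroupoid (B : Type u)
    [Ring B] [Algebra ℂ B] [StarRing B] [StarModule ℂ B] [Coalgebra ℂ B]
    [WeakHopfCStarAlgebra B] where
  C : Type u
  [ring : Ring C]
  [algebra : Algebra ℂ C]
  [starRing : StarRing C]
  [starModule : StarModule ℂ C]
  [coalgebra : Coalgebra ℂ C]
  [weakHopf : WeakHopfCStarAlgebra C]
  π : WeakHopfHom B C
  surjective : Function.Surjective π.toStarAlgHom

attribute [instance] QuantumSubgroupoid.ring QuantumSubgroupoid.algebra
  QuantumSubgroupoid.starRing QuantumSubgroupoid.starModule QuantumSubgroupoid.coalgebra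
  QuantumSubgroupoid.weakHopf

/-- The quotient type coideal `I(H \ G) = {b | (π ⊗ id)Δ(b) = (π ⊗ id)((1 ⊗ b)Δ(1))}` of a
quantum subgroupoid `(H, π)`. -/
noncomputable def quotientTypeCoideal {B : Type u}
    [Ring B] [Algebra ℂ B] [StarRing B] [StarModule ℂ B] [Coalgebra ℂ B] [WeakHopfCStarAlgebra B]
    (H : QuantumSubgroupoid B) : Submodule ℂ B where
  carrier := {b | TensorProduct.map H.π.toStarAlgHom.toAlgHom.toLinearMap LinearMap.id
      (Coalgebra.comul (R := ℂ) b) =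
    TensorProduct.map H.π.toStarAlgHom.toAlgHom.toLinearMap LinearMap.id
      (((1 : B) ⊗ₜ[ℂ] b) * Coalgebra.comul (R := ℂ) (1 : B))}
  zero_mem' := by simp
  add_mem' {a b} ha hb := by
    simp only [Set.mem_ofPred_eq] at ha hb ⊢
    simp [TensorProduct.tmul_add, add_mul, ha, hb]
  smul_mem' c a ha := by
    simp only [Set.mem_ofPred_eq] at ha ⊢
    simp [ha]

/-- The whole weak Hopf C*-algebra, as a quantum subgroupoid of itself. -/
noncomputable def QuantumSubgroupoid.self (B : Type u)
    [Ring B] [Algebra ℂ B] [StarRing B] [StarModule ℂ B] [Coalgebra ℂ B]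
    [WeakHopfCStarAlgebra B] : QuantumSubgroupoid B where
  C := B
  π :=
    { toStarAlgHom := StarAlgHom.id ℂ B
      map_comul := fun b => by
        have : (StarAlgHom.id ℂ B).toAlgHom.toLinearMap = LinearMap.id := rfl
        rw [this, TensorProduct.map_id]; rfl
      map_antipode := fun _ => rfl
      map_counit := fun _ => rfl }
  surjective := fun b => ⟨b, rfl⟩

end WeakHopf

/-! ## Finite direct sums of full matrix algebras: bases and linear maps -/

section Blocks

set_option linter.unusedSectionVars false

variable {ι : Type u} {n : ι → Type u}

/-- The matrix unit `e^i_{a,b}` of `⨁ i, M_{n i}(ℂ)`. -/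
noncomputable def blockUnit [DecidableEq ι] [∀ i, DecidableEq (n i)] (i : ι) (a b : n i) :
    ∀ i, Matrix (n i) (n i) ℂ :=
  Pi.single i (Matrix.single a b 1)

/-- The linear map on `⨁ i, M_{n i}(ℂ)` sending the matrix unit `e^i_{a,b}` to `F i a b`. -/
noncomputable def blockLin {M : Type*} [AddCommGroup M] [Module ℂ M] [Fintype ι]
    [∀ i, Fintype (n i)] (F : ∀ i, n i → n i → M) : (∀ i, Matrix (n i) (n i) ℂ) →ₗ[ℂ] M where
  toFun A := ∑ i, ∑ a, ∑ b, A i a b • F i a b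
  map_add' A A' := by simp [add_smul, Finset.sum_add_distrib]
  map_smul' c A := by simp [mul_smul, Finset.smul_sum]

variable [DecidableEq ι] [∀ i, DecidableEq (n i)] [Fintype ι] [∀ i, Fintype (n i)]

theorem blockUnit_apply_apply (i : ι) (a b : n i) (a' b' : n i) :
    blockUnit i a b i a' b' = if a = a' ∧ b = b' then 1 else 0 := by
  simp [blockUnit, Matrix.single_apply]

theorem blockUnit_apply_ne {i j : ι} (h : j ≠ i) (a b : n i) :
    blockUnit i a b j = 0 := by
  simp [blockUnit, h]

theorem sum_blockUnit (A : ∀ i, Matrix (n i) (n i) ℂ) :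
    A = ∑ i, ∑ a, ∑ b, A i a b • blockUnit i a b := by
  funext j
  ext c d
  simp only [Finset.sum_apply, Pi.smul_apply, Matrix.sum_apply, Matrix.smul_apply]
  rw [Finset.sum_eq_single j]
  · simp [blockUnit_apply_apply, ite_and]
  · intro i _ hi
    simp [blockUnit_apply_ne (Ne.symm hi)]
  · simp

theorem blockLin_unit {M : Type*} [AddCommGroup M] [Module ℂ M] (F : ∀ i, n i → n i → M)
    (i : ι) (a b : n i) : blockLin F (blockUnit i a b) = F i a b := by
  change ∑ j, ∑ c, ∑ d, (blockUnit i a b) j c d • F j c d = _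
  rw [Finset.sum_eq_single i]
  · simp [blockUnit_apply_apply, ite_and]
  · intro j _ hj
    simp [blockUnit_apply_ne hj]
  · simp

theorem blockHom_ext {M : Type*} [AddCommGroup M] [Module ℂ M]
    {φ ψ : (∀ i, Matrix (n i) (n i) ℂ) →ₗ[ℂ] M}
    (h : ∀ i a b, φ (blockUnit i a b) = ψ (blockUnit i a b)) : φ = ψ := by
  refine LinearMap.ext fun A => ?_
  rw [sum_blockUnit A]
  simp only [map_sum, map_smul, h]

theorem blockUnit_mul (i : ι) (a b c d : n i) :
    blockUnit i a b * blockUnit i c d = if b = c then blockUnit i a d else 0 := by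
  unfold blockUnit
  rw [← Pi.single_mul]
  split_ifs with h
  · subst h; simp
  · simp [h]

theorem blockUnit_mul_ne {i j : ι} (h : i ≠ j) (a b : n i) (c d : n j) :
    blockUnit i a b * blockUnit j c d = 0 := by
  funext k
  by_cases hk : k = i
  · subst hk
    simp [blockUnit_apply_ne h]
  · simp [blockUnit_apply_ne hk]

theorem star_blockUnit (i : ι) (a b : n i) :
    star (blockUnit i a b) = blockUnit i b a := by
  funext k
  by_cases hk : k = i
  · subst hk
    simp [blockUnit, Matrix.star_eq_conjTranspose]
  · simp [blockUnit_apply_ne hk]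

theorem one_eq_sum_blockUnit :
    (1 : ∀ i, Matrix (n i) (n i) ℂ) = ∑ i, ∑ a, blockUnit i a a := by
  refine (sum_blockUnit (1 : ∀ i, Matrix (n i) (n i) ℂ)).trans ?_
  simp [Matrix.one_apply]

/-- A finite direct sum of matrix algebras acts faithfully on a finite-dimensional space. -/
theorem block_exists_faithful : ∃ (N : ℕ)
    (φ : (∀ i, Matrix (n i) (n i) ℂ) →⋆ₐ[ℂ] Matrix (Fin N) (Fin N) ℂ),
    Function.Injective φ := by
  classical
  let e := Fintype.equivFin (Σ i, n i)
  refine ⟨_, { toFun := fun A => Matrix.reindexAlgEquiv ℂ ℂ e (Matrix.blockDiagonal' A)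
               map_one' := by simp
               map_mul' := fun A A' => by
                rw [← map_mul, ← Matrix.blockDiagonal'_mul]; rfl
               map_zero' := by simp
               map_add' := fun A A' => by
                rw [← map_add, ← Matrix.blockDiagonal'_add]
               commutes' := fun r => ?_
               map_star' := fun A => ?_ }, ?_⟩
  · rw [← AlgEquiv.commutes (Matrix.reindexAlgEquiv ℂ ℂ e) r]
    congr 1
    simp only [Algebra.algebraMap_eq_smul_one]
    rw [Matrix.blockDiagonal'_smul, Matrix.blockDiagonal'_one]
  · simp only [Matrix.star_eq_conjTranspose, Matrix.coe_reindexAlgEquiv, Matrix.reindex_apply]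
    rw [Matrix.conjTranspose_submatrix, Matrix.blockDiagonal'_conjTranspose]
    rfl
  · intro A A' h
    exact Matrix.blockDiagonal'_injective ((Matrix.reindexAlgEquiv ℂ ℂ e).injective h)

end Blocks

/-! ## Transport of the weak Hopf C*-algebra axioms along a surjection -/

section Transport

variable {B C : Type u} [Ring B] [Algebra ℂ B] [Coalgebra ℂ B]
  [Ring C] [Algebra ℂ C]

/-- Coalgebra structure on the image of a coalgebra. -/
noncomputable abbrev coalgebraOfSurjective (π : B →ₐ[ℂ] C) (hπ : Function.Surjective π)
    (Δ : C →ₗ[ℂ] C ⊗[ℂ] C) (ε : C →ₗ[ℂ] ℂ)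
    (hΔ : ∀ b, Δ (π b) = TensorProduct.map π.toLinearMap π.toLinearMap
      (Coalgebra.comul (R := ℂ) b))
    (hε : ∀ b, ε (π b) = Coalgebra.counit (R := ℂ) b) : Coalgebra ℂ C where
  comul := Δ
  counit := ε
  coassoc := by
    ext c
    obtain ⟨b, rfl⟩ := hπ c
    have h1 : Δ.rTensor C ∘ₗ TensorProduct.map π.toLinearMap π.toLinearMap =
        TensorProduct.map (TensorProduct.map π.toLinearMap π.toLinearMap) π.toLinearMap ∘ₗ
          (Coalgebra.comul (R := ℂ) (A := B)).rTensor B := by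
      ext x y; simp [hΔ]
    have h2 : Δ.lTensor C ∘ₗ TensorProduct.map π.toLinearMap π.toLinearMap =
        TensorProduct.map π.toLinearMap (TensorProduct.map π.toLinearMap π.toLinearMap) ∘ₗ
          (Coalgebra.comul (R := ℂ) (A := B)).lTensor B := by
      ext x y; simp [hΔ]
    have h3 : (TensorProduct.assoc ℂ C C C).toLinearMap ∘ₗ
        TensorProduct.map (TensorProduct.map π.toLinearMap π.toLinearMap) π.toLinearMap =
        TensorProduct.map π.toLinearMap (TensorProduct.map π.toLinearMap π.toLinearMap) ∘ₗ
          (TensorProduct.assoc ℂ B B B).toLinearMap := by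
      ext x y; simp
    have e1 := LinearMap.congr_fun h1 (Coalgebra.comul (R := ℂ) b)
    have e2 := LinearMap.congr_fun h2 (Coalgebra.comul (R := ℂ) b)
    have e3 := LinearMap.congr_fun h3 ((Coalgebra.comul (R := ℂ) (A := B)).rTensor B
      (Coalgebra.comul (R := ℂ) b))
    simp only [LinearMap.comp_apply, LinearEquiv.coe_coe] at e1 e2 e3 ⊢
    rw [hΔ, e1, e2, e3, Coalgebra.coassoc_apply]
  rTensor_counit_comp_comul := by
    ext c
    obtain ⟨b, rfl⟩ := hπ c
    have h1 : ε.rTensor C ∘ₗ TensorProduct.map π.toLinearMap π.toLinearMap =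
        TensorProduct.map LinearMap.id π.toLinearMap ∘ₗ
          (Coalgebra.counit (R := ℂ) (A := B)).rTensor B := by
      ext x y; simp [hε]
    have e1 := LinearMap.congr_fun h1 (Coalgebra.comul (R := ℂ) b)
    simp only [LinearMap.comp_apply] at e1 ⊢
    rw [hΔ, e1, Coalgebra.rTensor_counit_comul]
    simp
  lTensor_counit_comp_comul := by
    ext c
    obtain ⟨b, rfl⟩ := hπ c
    have h1 : ε.lTensor C ∘ₗ TensorProduct.map π.toLinearMap π.toLinearMap =
        TensorProduct.map π.toLinearMap LinearMap.id ∘ₗ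
          (Coalgebra.counit (R := ℂ) (A := B)).lTensor B := by
      ext x y; simp [hε]
    have e1 := LinearMap.congr_fun h1 (Coalgebra.comul (R := ℂ) b)
    simp only [LinearMap.comp_apply] at e1 ⊢
    rw [hΔ, e1, Coalgebra.lTensor_counit_comul]
    simp

variable [StarRing B] [StarModule ℂ B] [StarRing C] [StarModule ℂ C] [Coalgebra ℂ C]

/-- Weak Hopf C*-algebra structure on the image of a weak Hopf C*-algebra. -/
noncomputable abbrev weakHopfOfSurjective [WeakHopfCStarAlgebra B]
    (π : B →⋆ₐ[ℂ] C) (hπ : Function.Surjective π)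
    (S : C →ₗ[ℂ] C)
    (hC : ∃ (N : ℕ) (φ : C →⋆ₐ[ℂ] Matrix (Fin N) (Fin N) ℂ), Function.Injective φ)
    (hΔ : ∀ b, Coalgebra.comul (R := ℂ) (π b) =
      TensorProduct.map π.toAlgHom.toLinearMap π.toAlgHom.toLinearMap
        (Coalgebra.comul (R := ℂ) b))
    (hε : ∀ b, Coalgebra.counit (R := ℂ) (π b) = Coalgebra.counit (R := ℂ) b)
    (hS : ∀ b, S (π b) = π (WeakHopfCStarAlgebra.antipode b)) : WeakHopfCStarAlgebra C :=
  let p : B →ₐ[ℂ] C := π.toAlgHom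
  have hp : ∀ b, p b = π b := fun _ => rfl
  have hpp : ∀ x y : B ⊗[ℂ] B, TensorProduct.map p.toLinearMap p.toLinearMap (x * y) =
      TensorProduct.map p.toLinearMap p.toLinearMap x *
        TensorProduct.map p.toLinearMap p.toLinearMap y :=
    fun x y => map_mul (Algebra.TensorProduct.map p p) x y
  have h1 : Coalgebra.comul (R := ℂ) (1 : C) = TensorProduct.map p.toLinearMap p.toLinearMap
        (Coalgebra.comul (R := ℂ) (1 : B)) := by rw [← hΔ, map_one π]
  have hεc : (Coalgebra.counit (R := ℂ) (A := C)) ∘ₗ p.toLinearMap = Coalgebra.counit :=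
    LinearMap.ext hε
  have hΔc : (Coalgebra.comul (R := ℂ) (A := C)) ∘ₗ p.toLinearMap =
      TensorProduct.map p.toLinearMap p.toLinearMap ∘ₗ Coalgebra.comul :=
    LinearMap.ext hΔ
  have hSc : S ∘ₗ p.toLinearMap = p.toLinearMap ∘ₗ WeakHopfCStarAlgebra.antipode :=
    LinearMap.ext hS
  { finite := by
      have := WeakHopfCStarAlgebra.finite (B := B)
      exact Module.Finite.of_surjective p.toLinearMap hπ
    exists_faithful := hC
    comul_mul := fun b c => by
      obtain ⟨b, rfl⟩ := hπ b
      obtain ⟨c, rfl⟩ := hπ c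
      rw [← map_mul, hΔ, hΔ, hΔ, WeakHopfCStarAlgebra.comul_mul]
      exact hpp _ _
    counit_mul := fun b c d => by
      obtain ⟨b, rfl⟩ := hπ b
      obtain ⟨c, rfl⟩ := hπ c
      obtain ⟨d, rfl⟩ := hπ d
      rw [← map_mul, ← map_mul, hΔ, hε, ← WeakHopfCStarAlgebra.counit_mul,
        ← LinearMap.comp_apply (TensorProduct.map _ _), ← TensorProduct.map_comp]
      have e1 : (Coalgebra.counit (R := ℂ) (A := C) ∘ₗ LinearMap.mulLeft ℂ (π b)) ∘ₗ
          π.toAlgHom.toLinearMap = Coalgebra.counit (R := ℂ) (A := B) ∘ₗ LinearMap.mulLeft ℂ b := by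
        ext x
        change Coalgebra.counit (R := ℂ) (π b * π x) = Coalgebra.counit (R := ℂ) (b * x)
        rw [← map_mul, hε]
      have e2 : (Coalgebra.counit (R := ℂ) (A := C) ∘ₗ LinearMap.mulRight ℂ (π d)) ∘ₗ
          π.toAlgHom.toLinearMap =
          Coalgebra.counit (R := ℂ) (A := B) ∘ₗ LinearMap.mulRight ℂ d := by
        ext x
        change Coalgebra.counit (R := ℂ) (π x * π d) = Coalgebra.counit (R := ℂ) (x * d)
        rw [← map_mul, hε]
      rw [e1, e2]
    comul_one := by
      have key := congrArg (TensorProduct.map (TensorProduct.map p.toLinearMap p.toLinearMap)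
        p.toLinearMap) (WeakHopfCStarAlgebra.comul_one (B := B))
      have hppp : ∀ x y : (B ⊗[ℂ] B) ⊗[ℂ] B,
          TensorProduct.map (TensorProduct.map p.toLinearMap p.toLinearMap) p.toLinearMap (x * y) =
          TensorProduct.map (TensorProduct.map p.toLinearMap p.toLinearMap) p.toLinearMap x *
          TensorProduct.map (TensorProduct.map p.toLinearMap p.toLinearMap) p.toLinearMap y :=
        fun x y => map_mul (Algebra.TensorProduct.map (Algebra.TensorProduct.map p p) p) x y
      rw [hppp] at key
      have h3 : TensorProduct.map (TensorProduct.map p.toLinearMap p.toLinearMap) p.toLinearMap ∘ₗ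
          (TensorProduct.assoc ℂ B B B).symm.toLinearMap =
          (TensorProduct.assoc ℂ C C C).symm.toLinearMap ∘ₗ
          TensorProduct.map p.toLinearMap (TensorProduct.map p.toLinearMap p.toLinearMap) := by
        ext x y; simp
      have e3 := LinearMap.congr_fun h3 ((1 : B) ⊗ₜ[ℂ] Coalgebra.comul (R := ℂ) (1 : B))
      simp only [LinearMap.comp_apply, LinearEquiv.coe_coe] at e3
      rw [e3] at key
      simp only [TensorProduct.map_tmul, AlgHom.toLinearMap_apply, map_one, ← h1] at key
      have h4 : TensorProduct.map (TensorProduct.map p.toLinearMap p.toLinearMap) p.toLinearMap ∘ₗ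
          TensorProduct.map Coalgebra.comul LinearMap.id =
          TensorProduct.map Coalgebra.comul LinearMap.id ∘ₗ
          TensorProduct.map p.toLinearMap p.toLinearMap := by
        rw [← TensorProduct.map_comp, ← TensorProduct.map_comp, hΔc]
        rfl
      rw [key, h1]
      exact LinearMap.congr_fun h4 _
    antipode := S
    antipode_one := by
      rw [← map_one π, hS, WeakHopfCStarAlgebra.antipode_one]
    antipode_mul := fun b c => by
      obtain ⟨b, rfl⟩ := hπ b
      obtain ⟨c, rfl⟩ := hπ c
      rw [← map_mul, hS, hS, hS, WeakHopfCStarAlgebra.antipode_mul, map_mul]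
    counit_antipode := fun b => by
      obtain ⟨b, rfl⟩ := hπ b
      rw [hS, hε, hε, WeakHopfCStarAlgebra.counit_antipode]
    comul_antipode := fun b => by
      obtain ⟨b, rfl⟩ := hπ b
      rw [hS, hΔ, hΔ, WeakHopfCStarAlgebra.comul_antipode]
      have : TensorProduct.map S S ∘ₗ (TensorProduct.comm ℂ C C).toLinearMap ∘ₗ
          TensorProduct.map p.toLinearMap p.toLinearMap =
          TensorProduct.map p.toLinearMap p.toLinearMap ∘ₗ
          TensorProduct.map WeakHopfCStarAlgebra.antipode WeakHopfCStarAlgebra.antipode ∘ₗ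
          (TensorProduct.comm ℂ B B).toLinearMap := by
        ext x y; simp [hp, hS]
      exact (LinearMap.congr_fun this (Coalgebra.comul (R := ℂ) b)).symm
    mul_antipode_right := fun b => by
      obtain ⟨b, rfl⟩ := hπ b
      have := congrArg π (WeakHopfCStarAlgebra.mul_antipode_right b)
      have e1 : LinearMap.mul' ℂ C ∘ₗ TensorProduct.map LinearMap.id S ∘ₗ
          TensorProduct.map p.toLinearMap p.toLinearMap =
          p.toLinearMap ∘ₗ LinearMap.mul' ℂ B ∘ₗ
          TensorProduct.map LinearMap.id WeakHopfCStarAlgebra.antipode := by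
        ext x y; simp [hp, hS]
      have e2 := LinearMap.congr_fun e1 (Coalgebra.comul (R := ℂ) b)
      simp only [LinearMap.comp_apply] at e2
      rw [hΔ]
      refine e2.trans (this.trans ?_)
      change π (TensorProduct.lid ℂ B (TensorProduct.map Coalgebra.counit LinearMap.id
        (Coalgebra.comul (R := ℂ) (1 : B) * (b ⊗ₜ[ℂ] (1 : B))))) =
        TensorProduct.lid ℂ C (TensorProduct.map Coalgebra.counit LinearMap.id
        (Coalgebra.comul (R := ℂ) (1 : C) * (π b ⊗ₜ[ℂ] (1 : C))))
      have e4 : π b ⊗ₜ[ℂ] (1 : C) = TensorProduct.map p.toLinearMap p.toLinearMap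
          (b ⊗ₜ[ℂ] (1 : B)) := by simp [hp]
      rw [h1, e4, ← hpp]
      have e5 : (TensorProduct.lid ℂ C).toLinearMap ∘ₗ
          TensorProduct.map Coalgebra.counit LinearMap.id ∘ₗ
          TensorProduct.map p.toLinearMap p.toLinearMap = p.toLinearMap ∘ₗ
          (TensorProduct.lid ℂ B).toLinearMap ∘ₗ
          TensorProduct.map Coalgebra.counit LinearMap.id := by
        ext x y; simp [hp, hε]
      exact (LinearMap.congr_fun e5 _).symm
    mul_antipode_left := fun b => by
      obtain ⟨b, rfl⟩ := hπ b
      have := congrArg π (WeakHopfCStarAlgebra.mul_antipode_left b)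
      have e1 : LinearMap.mul' ℂ C ∘ₗ TensorProduct.map S LinearMap.id ∘ₗ
          TensorProduct.map p.toLinearMap p.toLinearMap =
          p.toLinearMap ∘ₗ LinearMap.mul' ℂ B ∘ₗ
          TensorProduct.map WeakHopfCStarAlgebra.antipode LinearMap.id := by
        ext x y; simp [hp, hS]
      have e2 := LinearMap.congr_fun e1 (Coalgebra.comul (R := ℂ) b)
      simp only [LinearMap.comp_apply] at e2
      rw [hΔ]
      refine e2.trans (this.trans ?_)
      change π (TensorProduct.rid ℂ B (TensorProduct.map LinearMap.id Coalgebra.counit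
        (((1 : B) ⊗ₜ[ℂ] b) * Coalgebra.comul (R := ℂ) (1 : B)))) =
        TensorProduct.rid ℂ C (TensorProduct.map LinearMap.id Coalgebra.counit
        (((1 : C) ⊗ₜ[ℂ] π b) * Coalgebra.comul (R := ℂ) (1 : C)))
      have e4 : (1 : C) ⊗ₜ[ℂ] π b = TensorProduct.map p.toLinearMap p.toLinearMap
          ((1 : B) ⊗ₜ[ℂ] b) := by simp [hp]
      rw [h1, e4, ← hpp]
      have e5 : (TensorProduct.rid ℂ C).toLinearMap ∘ₗ
          TensorProduct.map LinearMap.id Coalgebra.counit ∘ₗ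
          TensorProduct.map p.toLinearMap p.toLinearMap = p.toLinearMap ∘ₗ
          (TensorProduct.rid ℂ B).toLinearMap ∘ₗ
          TensorProduct.map LinearMap.id Coalgebra.counit := by
        ext x y; simp [hp, hε]
      exact (LinearMap.congr_fun e5 _).symm
    comul_star := fun b => by
      obtain ⟨b, rfl⟩ := hπ b
      rw [← map_star, hΔ, hΔ, WeakHopfCStarAlgebra.comul_star]
      generalize Coalgebra.comul (R := ℂ) b = t
      induction t with
      | zero => simp
      | tmul x y =>
        change π (star x) ⊗ₜ[ℂ] π (star y) = star (π x) ⊗ₜ[ℂ] star (π y)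
        rw [map_star, map_star]
      | add x y hx hy => simp only [star_add, map_add, hx, hy] }

end Transport

/-! ## The Tambara-Yamagami weak Hopf C*-algebra -/

/-- Tambara-Yamagami data on a finite abelian group `G` (written additively): a non-degenerate
symmetric bicharacter `χ` with values in the unit circle and a number `τ = ± |G|^{-1/2}`. -/
structure TYData (G : Type u) [AddCommGroup G] [Fintype G] where
  χ : G → G → Circle
  χ_add : ∀ g h k, χ g (h + k) = χ g h * χ g k
  χ_symm : ∀ g h, χ g h = χ h g
  χ_nondegenerate : ∀ g, (∀ h, χ g h = 1) → g = 0
  τ : ℝ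
  τ_eq : τ = 1 / Real.sqrt (Fintype.card G) ∨ τ = -(1 / Real.sqrt (Fintype.card G))

/-- The index set `Ω_x` of the basis of `H^x`, for `x ∈ Ω = G ⊔ {m}`, where `Ω` is `Option G` and
`m` is `none`: `Ω_g = Ω` for `g ∈ G`, and `Ω_m = G ⊔ Ḡ` (with `k` as `inl k` and `k̄` as
`inr k`). -/
abbrev TYIdx (G : Type u) : Option G → Type u
  | some _ => Option G
  | none => G ⊕ G

instance TYIdx.instFintype (G : Type u) [Fintype G] : ∀ x : Option G, Fintype (TYIdx G x)
  | some _ => inferInstanceAs (Fintype (Option G))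
  | none => inferInstanceAs (Fintype (G ⊕ G))

instance TYIdx.instDecidableEq (G : Type u) [DecidableEq G] :
    ∀ x : Option G, DecidableEq (TYIdx G x)
  | some _ => inferInstanceAs (DecidableEq (Option G))
  | none => inferInstanceAs (DecidableEq (G ⊕ G))

/-- `α - g` for `α ∈ Ω = G ⊔ {m}` and `g ∈ G`, with the convention `m - g = m`. -/
def tyShift {G : Type u} [AddCommGroup G] (α : Option G) (g : G) : Option G :=
  α.map (fun h => h - g)

section TY

set_option linter.unusedSectionVars false
set_option linter.unusedVariables false
set_option linter.unusedSimpArgs false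

variable {G : Type u} [AddCommGroup G] [Fintype G] [DecidableEq G]

/-- The basis vector `v^x_α` of `⨁ x, H^x`, where `H^x` is the space of functions on `Ω_x`. -/
noncomputable def tyVec (x : Option G) (α : TYIdx G x) : ∀ x, TYIdx G x → ℂ :=
  Pi.single x (Pi.single α 1)

/-- The products `v^x_α ∘ v^y_γ` of basis vectors. -/
noncomputable def tyCirc (D : TYData G) :
    ∀ x y : Option G, TYIdx G x → TYIdx G y → (∀ z, TYIdx G z → ℂ)
  | some g, some h, some k, z =>
      if z = some (h + k) then tyVec (some (g + h)) (some (h + k)) else 0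
  | some g, some h, none, z => if z = none then tyVec (some (g + h)) none else 0
  | none, some g, Sum.inl k, z =>
      if z = none then (D.χ g k : ℂ) • tyVec none (Sum.inl k) else 0
  | none, some g, Sum.inr k, z =>
      if z = some (g + k) then tyVec none (Sum.inr (g + k)) else 0
  | some g, none, z, Sum.inr k =>
      if z = none then (D.χ g k : ℂ) • tyVec none (Sum.inr k) else 0
  | some g, none, z, Sum.inl k => if z = some k then tyVec none (Sum.inl (k - g)) else 0
  | none, none, Sum.inl h, Sum.inr k => tyVec (some (k - h)) (some k)
  | none, none, Sum.inr h, Sum.inl k =>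
      if h = k then (D.τ : ℂ) • ∑ g : G, ((D.χ g h)⁻¹ : ℂ) • tyVec (some g) none else 0
  | none, none, Sum.inl _, Sum.inl _ => 0
  | none, none, Sum.inr _, Sum.inr _ => 0

/-- The vector space `B = ⨁ x, H^x ⊗ H̄^x`; `H^x ⊗ H̄^x` is the space of square matrices indexed by
`Ω_x`, the tensor `v ⊗ w̄` being the matrix `(v_α w̄_β)`. -/
def TYAlg (_D : TYData G) : Type u := ∀ x : Option G, Matrix (TYIdx G x) (TYIdx G x) ℂ

variable (D : TYData G)

noncomputable instance : AddCommGroup (TYAlg D) :=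
  inferInstanceAs (AddCommGroup (∀ x : Option G, Matrix (TYIdx G x) (TYIdx G x) ℂ))

noncomputable instance : Module ℂ (TYAlg D) :=
  inferInstanceAs (Module ℂ (∀ x : Option G, Matrix (TYIdx G x) (TYIdx G x) ℂ))

/-- For `v, w ∈ ⨁ x, H^x`, the element of `B` with components `v^x ⊗ w̄^x`. -/
noncomputable def tyTens (v w : ∀ x, TYIdx G x → ℂ) : TYAlg D :=
  fun x => Matrix.vecMulVec (v x) (star (w x))

/-- The basis element `f^x_{α,β} = v^x_α ⊗ v̄^x_β` of `B`. -/
noncomputable def tyF (x : Option G) (α β : TYIdx G x) : TYAlg D :=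
  tyTens D (tyVec x α) (tyVec x β)

/-- The linear map on `B` sending `f^x_{α,β}` to `F x α β`. -/
noncomputable def tyLin {M : Type*} [AddCommGroup M] [Module ℂ M]
    (F : ∀ x, TYIdx G x → TYIdx G x → M) : TYAlg D →ₗ[ℂ] M :=
  blockLin F

/-- The product of `B`: `f^x_{α,β} f^y_{γ,δ} = (v^x_α ∘ v^y_γ) ⊗ (v^x_β ∘ v^y_δ)¯`. -/
noncomputable instance : Mul (TYAlg D) where
  mul a b := ∑ x, ∑ α, ∑ β, ∑ y, ∑ γ, ∑ δ,
    (a x α β * b y γ δ) • tyTens D (tyCirc D x y α γ) (tyCirc D x y β δ)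

/-- The unit of `B`: the sum of all `f^0_{α,β}`. -/
noncomputable instance : One (TYAlg D) where
  one := ∑ α : Option G, ∑ β : Option G, tyF D (some 0) α β

/-- `(f^x_{α,β})^*`. -/
noncomputable def tyStarF : ∀ x : Option G, TYIdx G x → TYIdx G x → TYAlg D
  | some g, α, β => tyF D (some (-g)) (tyShift α g) (tyShift β g)
  | none, Sum.inl g, Sum.inl h => tyF D none (Sum.inr g) (Sum.inr h)
  | none, Sum.inl g, Sum.inr h => (D.τ : ℂ) • tyF D none (Sum.inr g) (Sum.inl h)
  | none, Sum.inr g, Sum.inl h => (D.τ : ℂ)⁻¹ • tyF D none (Sum.inl g) (Sum.inr h)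
  | none, Sum.inr g, Sum.inr h => tyF D none (Sum.inl g) (Sum.inl h)

/-- `S(f^x_{α,β})`. -/
noncomputable def tyAntipodeF : ∀ x : Option G, TYIdx G x → TYIdx G x → TYAlg D
  | some g, α, β => tyF D (some (-g)) (tyShift β g) (tyShift α g)
  | none, Sum.inl g, Sum.inl h => tyF D none (Sum.inr h) (Sum.inr g)
  | none, Sum.inl g, Sum.inr h => (D.τ : ℂ)⁻¹ • tyF D none (Sum.inl h) (Sum.inr g)
  | none, Sum.inr g, Sum.inl h => (D.τ : ℂ) • tyF D none (Sum.inr h) (Sum.inl g)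
  | none, Sum.inr g, Sum.inr h => tyF D none (Sum.inl h) (Sum.inl g)

/-- The involution of `B`, the antilinear extension of `tyStarF`. -/
noncomputable instance : Star (TYAlg D) where
  star b := ∑ x, ∑ α, ∑ β, (starRingEnd ℂ (b x α β)) • tyStarF D x α β

/-- The coproduct `Δ(f^x_{α,β}) = ∑ γ, f^x_{α,γ} ⊗ f^x_{γ,β}` and the counit
`ε(f^x_{α,β}) = δ_{α,β}`. -/
noncomputable instance : CoalgebraStruct ℂ (TYAlg D) where
  comul := tyLin D fun x α β => ∑ γ, tyF D x α γ ⊗ₜ[ℂ] tyF D x γ β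
  counit := tyLin D fun x α β => if α = β then 1 else 0

/-- The matrix unit `e^x_{y,z}` of `⨁ x, B(H^x)`. -/
noncomputable abbrev tyE (x : Option G) (y z : TYIdx G x) :
    ∀ x : Option G, Matrix (TYIdx G x) (TYIdx G x) ℂ :=
  blockUnit x y z

/-- The basis elements `f^x_{α,β}` of `B` written in terms of the matrix units `e^x_{y,z}` of the
C*-algebra `B`. -/
noncomputable def tyThetaF :
    ∀ x : Option G, TYIdx G x → TYIdx G x →
      (∀ x : Option G, Matrix (TYIdx G x) (TYIdx G x) ℂ)
  | some g, some h, some k => tyE (some (h - k)) (some (g - k)) (some (-k))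
  | some g, none, none => ∑ d : G, (D.χ g d : ℂ) • tyE (some d) none none
  | some g, some k, none => tyE none (Sum.inl (k - g)) (Sum.inl k)
  | some g, none, some k => tyE none (Sum.inr (k - g)) (Sum.inr k)
  | none, Sum.inl h, Sum.inl k => tyE (some (h - k)) (some (-k)) none
  | none, Sum.inr h, Sum.inr k => tyE (some (h - k)) none (some (-k))
  | none, Sum.inl h, Sum.inr k =>
      ((D.τ : ℂ) * (D.χ h k : ℂ)⁻¹) • tyE none (Sum.inl h) (Sum.inr k)
  | none, Sum.inr h, Sum.inl k => (D.χ h k : ℂ) • tyE none (Sum.inr k) (Sum.inl h)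

/-- The isomorphism of `B` with the direct sum of full matrix algebras `⨁ x, B(H^x)`. -/
noncomputable def tyTheta : TYAlg D →ₗ[ℂ] (∀ x : Option G, Matrix (TYIdx G x) (TYIdx G x) ℂ) :=
  tyLin D (tyThetaF D)

theorem tyF_eq (x : Option G) (α β : TYIdx G x) : tyF D x α β = blockUnit x α β := by
  funext z
  by_cases h : z = x
  · subst h
    ext i j
    rw [blockUnit_apply_apply]
    simp only [tyF, tyTens, tyVec, Matrix.vecMulVec_apply, Pi.single_eq_same, Pi.star_apply,
      Pi.single_apply, apply_ite star, star_one, star_zero, ite_and, @eq_comm _ i, @eq_comm _ j]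
    split_ifs <;> simp
  · rw [blockUnit_apply_ne h]
    ext i j
    simp [tyF, tyTens, tyVec, Matrix.vecMulVec_apply, h]

theorem tyTens_vec_some (a b : G) (i j : Option G) :
    tyTens D (tyVec (some a) i) (tyVec (some b) j) = if a = b then tyF D (some a) i j else 0 := by
  split_ifs with h
  · subst h; rfl
  · funext z
    ext k l
    change tyVec (some a) i z k * star (tyVec (some b) j z l) = 0
    by_cases hz : z = some a
    · have : z ≠ some b := by rw [hz]; simpa using h
      simp [tyVec, this]
    · simp [tyVec, hz]

theorem tyTens_some_none (a : G) (i : Option G) (j : G ⊕ G) :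
    tyTens D (tyVec (some a) i) (tyVec none j) = 0 := by
  funext z
  ext k l
  change tyVec (some a) i z k * star (tyVec none j z l) = 0
  by_cases hz : z = some a
  · have : z ≠ none := by rw [hz]; simp
    simp [tyVec, this]
  · simp [tyVec, hz]

theorem tyTens_none_some (a : G) (i : Option G) (j : G ⊕ G) :
    tyTens D (tyVec none j) (tyVec (some a) i) = 0 := by
  funext z
  ext k l
  change tyVec none j z k * star (tyVec (some a) i z l) = 0
  by_cases hz : z = some a
  · have : z ≠ none := by rw [hz]; simp
    simp [tyVec, this]
  · simp [tyVec, hz]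

theorem tyTens_none (i j : G ⊕ G) :
    tyTens D (tyVec none i) (tyVec none j) = tyF D none i j := rfl

theorem tyTens_zero_left (w : ∀ x, TYIdx G x → ℂ) : tyTens D 0 w = 0 := by
  funext z
  ext k l
  change (0 : ℂ) * _ = 0
  simp

theorem tyTens_zero_right (w : ∀ x, TYIdx G x → ℂ) : tyTens D w 0 = 0 := by
  funext z
  ext k l
  change _ * star (0 : ℂ) = 0
  simp

theorem tyTens_add_left (v v' w : ∀ x, TYIdx G x → ℂ) :
    tyTens D (v + v') w = tyTens D v w + tyTens D v' w := by
  funext z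
  ext k l
  change (v z k + v' z k) * _ = v z k * _ + v' z k * _
  ring

theorem tyTens_add_right (v w w' : ∀ x, TYIdx G x → ℂ) :
    tyTens D v (w + w') = tyTens D v w + tyTens D v w' := by
  funext z
  ext k l
  change v z k * star (w z l + w' z l) = v z k * star (w z l) + v z k * star (w' z l)
  rw [star_add]; ring

theorem tyTens_smul_left (c : ℂ) (v w : ∀ x, TYIdx G x → ℂ) :
    tyTens D (c • v) w = c • tyTens D v w := by
  funext z
  ext k l
  change (c * v z k) * _ = c * (v z k * _)
  ring

theorem tyTens_smul_right (c : ℂ) (v w : ∀ x, TYIdx G x → ℂ) :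
    tyTens D v (c • w) = starRingEnd ℂ c • tyTens D v w := by
  funext z
  ext k l
  change v z k * star (c * w z l) = star c * (v z k * star (w z l))
  rw [star_mul]; ring

theorem tyTens_sum_left {κ : Type*} (s : Finset κ) (v : κ → ∀ x, TYIdx G x → ℂ)
    (w : ∀ x, TYIdx G x → ℂ) :
    tyTens D (∑ i ∈ s, v i) w = ∑ i ∈ s, tyTens D (v i) w := by
  classical
  induction s using Finset.induction_on with
  | empty => simp [tyTens_zero_left]
  | insert a s ha ih => rw [Finset.sum_insert ha, Finset.sum_insert ha, tyTens_add_left, ih]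

theorem tyTens_sum_right {κ : Type*} (s : Finset κ) (v : κ → ∀ x, TYIdx G x → ℂ)
    (w : ∀ x, TYIdx G x → ℂ) :
    tyTens D w (∑ i ∈ s, v i) = ∑ i ∈ s, tyTens D w (v i) := by
  classical
  induction s using Finset.induction_on with
  | empty => simp [tyTens_zero_right]
  | insert a s ha ih => rw [Finset.sum_insert ha, Finset.sum_insert ha, tyTens_add_right, ih]

theorem tyTens_ite_left (p : Prop) [Decidable p] (v w : ∀ x, TYIdx G x → ℂ) :
    tyTens D (if p then v else 0) w = if p then tyTens D v w else 0 := by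
  split_ifs
  · rfl
  · exact tyTens_zero_left D w

theorem tyTens_ite_right (p : Prop) [Decidable p] (v w : ∀ x, TYIdx G x → ℂ) :
    tyTens D w (if p then v else 0) = if p then tyTens D w v else 0 := by
  split_ifs
  · rfl
  · exact tyTens_zero_right D w

theorem tyLin_tyF {M : Type*} [AddCommGroup M] [Module ℂ M]
    (F : ∀ x, TYIdx G x → TYIdx G x → M) (x : Option G) (α β : TYIdx G x) :
    tyLin D F (tyF D x α β) = F x α β := by
  rw [tyF_eq]
  exact blockLin_unit F x α β

theorem tyHom_ext {M : Type*} [AddCommGroup M] [Module ℂ M] {φ ψ : TYAlg D →ₗ[ℂ] M}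
    (h : ∀ x α β, φ (tyF D x α β) = ψ (tyF D x α β)) : φ = ψ := by
  refine blockHom_ext (φ := φ) (ψ := ψ) fun x α β => ?_
  have := h x α β
  rw [tyF_eq] at this
  exact this

theorem ty_sum (b : TYAlg D) : b = ∑ x, ∑ α, ∑ β, b x α β • tyF D x α β := by
  simp only [tyF_eq]
  exact sum_blockUnit b

theorem tyTheta_tyF (x : Option G) (α β : TYIdx G x) :
    tyTheta D (tyF D x α β) = tyThetaF D x α β := tyLin_tyF D _ x α β

theorem tyE_mul_some (a b : G) (i j k l : Option G) :
    tyE (G := G) (some a) i j * tyE (some b) k l =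
      if a = b ∧ j = k then tyE (some a) i l else 0 := by
  by_cases h : a = b
  · subst h
    rw [blockUnit_mul]
    simp
  · rw [blockUnit_mul_ne (by simpa using h)]
    simp [h]

theorem tyE_mul_none (i j k l : G ⊕ G) :
    tyE (G := G) none i j * tyE none k l = if j = k then tyE none i l else 0 :=
  blockUnit_mul _ _ _ _ _

theorem tyE_mul_some_none (a : G) (i j : Option G) (k l : G ⊕ G) :
    tyE (G := G) (some a) i j * tyE none k l = 0 :=
  blockUnit_mul_ne (by simp) _ _ _ _

theorem tyE_mul_none_some (a : G) (i j : Option G) (k l : G ⊕ G) :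
    tyE (G := G) none k l * tyE (some a) i j = 0 :=
  blockUnit_mul_ne (by simp) _ _ _ _

variable {D} in
theorem TYData.χ_add_left (g h k : G) : D.χ (g + h) k = D.χ g k * D.χ h k := by
  rw [D.χ_symm, D.χ_add, D.χ_symm k g, D.χ_symm k h]

variable {D} in
theorem TYData.χ_zero (g : G) : D.χ g 0 = 1 := by
  have := D.χ_add g 0 0
  simpa using this

variable {D} in
theorem TYData.χ_zero_left (g : G) : D.χ 0 g = 1 := by
  rw [D.χ_symm, D.χ_zero]

variable {D} in
theorem TYData.χ_neg (g h : G) : D.χ g (-h) = (D.χ g h)⁻¹ := by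
  have := D.χ_add g h (-h)
  rw [add_neg_cancel, D.χ_zero] at this
  exact (inv_eq_of_mul_eq_one_right this.symm).symm

variable {D} in
theorem TYData.χ_sub (g h k : G) : D.χ g (h - k) = D.χ g h / D.χ g k := by
  rw [sub_eq_add_neg, D.χ_add, D.χ_neg, div_eq_mul_inv]

variable {D} in
theorem TYData.χ_sub_left (g h k : G) : D.χ (g - h) k = D.χ g k / D.χ h k := by
  rw [D.χ_symm, D.χ_sub, D.χ_symm k g, D.χ_symm k h]

variable {D} in
theorem TYData.conj_χ (g h : G) : (starRingEnd ℂ) (D.χ g h : ℂ) = (D.χ g h : ℂ)⁻¹ := by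
  rw [← Circle.coe_inv_eq_conj, Circle.coe_inv]

variable {D} in
theorem TYData.τ_sq : D.τ ^ 2 = 1 / (Fintype.card G : ℝ) := by
  have h : (0 : ℝ) ≤ Fintype.card G := by positivity
  rcases D.τ_eq with h' | h' <;> rw [h'] <;> simp [Real.sq_sqrt h]

variable {D} in
theorem TYData.card_ne : (Fintype.card G : ℂ) ≠ 0 := by
  have : Nonempty G := ⟨0⟩
  simp

variable {D} in
theorem TYData.τ_sq' : (D.τ : ℂ) * (D.τ : ℂ) * (Fintype.card G : ℂ) = 1 := by
  have h := congrArg (fun r : ℝ => (r : ℂ)) D.τ_sq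
  simp only [Complex.ofReal_pow, Complex.ofReal_div, Complex.ofReal_one, Complex.ofReal_natCast] at h
  rw [← sq, h]
  field_simp [TYData.card_ne (G := G)]

variable {D} in
theorem TYData.τ_ne : (D.τ : ℂ) ≠ 0 := by
  intro h
  have := D.τ_sq'
  simp [h] at this

variable {D} in
theorem TYData.sum_χ (g : G) : ∑ h : G, (D.χ g h : ℂ) = if g = 0 then (Fintype.card G : ℂ) else 0 := by
  split_ifs with hg
  · subst hg
    simp [D.χ_zero_left]
  · by_contra hne
    apply hg
    apply D.χ_nondegenerate
    intro k
    have h1 : (D.χ g k : ℂ) * ∑ h : G, (D.χ g h : ℂ) = ∑ h : G, (D.χ g h : ℂ) := by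
      rw [Finset.mul_sum, ← Equiv.sum_comp (Equiv.addLeft k) (fun h => (D.χ g h : ℂ))]
      simp [D.χ_add]
    have h2 : (D.χ g k : ℂ) = 1 := by
      have := mul_right_cancel₀ (b := ∑ h : G, (D.χ g h : ℂ)) hne (h1.trans (one_mul _).symm)
      exact this
    exact Circle.coe_eq_one.mp h2

theorem tyTheta_circ (x y : Option G) (α β : TYIdx G x) (γ δ : TYIdx G y) :
    tyTheta D (tyTens D (tyCirc D x y α γ) (tyCirc D x y β δ)) =
      tyThetaF D x α β * tyThetaF D y γ δ := by
  rcases x with _ | g <;> rcases y with _ | h <;> rcases α with α | α <;>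
    rcases β with β | β <;> rcases γ with γ | γ <;> rcases δ with δ | δ <;>
    simp only [tyCirc, tyThetaF, tyTens_ite_left, tyTens_ite_right, tyTens_smul_left,
      tyTens_smul_right, tyTens_sum_left, tyTens_sum_right, tyTens_vec_some, tyTens_some_none,
      tyTens_none_some, tyTens_none, tyTens_zero_left, tyTens_zero_right, tyE_mul_some,
      tyE_mul_none, tyE_mul_some_none, tyE_mul_none_some, smul_mul_assoc, mul_smul_comm,
      apply_ite (tyTheta D), map_smul, map_sum, map_zero, tyTheta_tyF, smul_zero, mul_zero,
      zero_mul, Finset.sum_mul, Finset.mul_sum, reduceCtorEq, if_false, if_true,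
      Option.some.injEq, Sum.inl.injEq, Sum.inr.injEq, and_false, Finset.sum_const_zero, ite_self,
      and_true]
  · have : γ - α = δ - β ↔ α - β = γ - δ := by constructor <;> intro h <;> grind
    rw [if_congr this rfl rfl]
    split_ifs with h
    · rw [h, show γ - α - δ = -β by grind]
    · rfl
  · by_cases h : β = δ
    · subst h
      simp only [if_true, smul_ite, smul_zero, Finset.sum_ite_eq, Finset.mem_univ, sub_sub_cancel,
        map_inv₀, TYData.conj_χ, Complex.conj_ofReal, smul_smul, inv_inv]
      congr 1
      rw [D.χ_sub_left, Circle.coe_div]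
      ring
    · simp [h]
  · by_cases h : α = γ
    · subst h
      simp only [if_true, smul_ite, smul_zero, Finset.sum_ite_eq', Finset.mem_univ, sub_sub_cancel,
        smul_smul]
      congr 1
      rw [D.χ_sub_left, Circle.coe_div, D.χ_symm δ, D.χ_symm β]
      field_simp
    · simp [h]
  · by_cases h : β = δ
    · subst h
      by_cases h' : α = γ
      · subst h'
        simp only [if_true, Finset.smul_sum, smul_ite, smul_zero, Finset.sum_ite_eq',
          Finset.sum_ite_eq, Finset.mem_univ, smul_smul, map_inv₀, TYData.conj_χ,
          Complex.conj_ofReal, inv_inv]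
        rw [Finset.sum_comm]
        have key : ∀ y : G, ∑ x : G, ((D.τ : ℂ) * ((D.χ x β : ℂ) * ((D.τ : ℂ) * ((D.χ x α : ℂ)⁻¹ *
            (D.χ x y : ℂ))))) • tyE (G := G) (some y) none none =
            if y = α - β then tyE (some (α - β)) none none else 0 := by
          intro y
          rw [← Finset.sum_smul]
          have h2 : ∑ x : G, ((D.τ : ℂ) * ((D.χ x β : ℂ) * (↑D.τ * ((D.χ x α : ℂ)⁻¹ *
            (D.χ x y : ℂ))))) = D.τ * D.τ * ∑ x : G, (D.χ (β - α + y) x : ℂ) := by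
            rw [Finset.mul_sum]
            refine Finset.sum_congr rfl fun x _ => ?_
            rw [D.χ_symm (β - α + y), D.χ_add, D.χ_sub, Circle.coe_mul, Circle.coe_div]
            field_simp
          rw [h2, D.sum_χ]
          have h3 : β - α + y = 0 ↔ y = α - β := by constructor <;> intro h <;> grind
          rw [if_congr h3 rfl rfl]
          split_ifs with h4
          · rw [D.τ_sq', one_smul, h4]
          · simp
        rw [Finset.sum_congr rfl fun y _ => key y]
        simp
      · simp [h']
    · simp [h]
  · simp only [smul_ite, smul_zero, Finset.sum_ite_eq, Finset.mem_univ, if_true, TYData.conj_χ,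
      smul_smul]
    congr 1
    rw [D.χ_sub, Circle.coe_div]
    field_simp
  · have : δ = h + β ↔ β = δ - h := by constructor <;> intro h <;> grind
    rw [if_congr this rfl rfl]
    split_ifs with h'
    · subst h'
      rw [smul_smul, add_sub_cancel]
      congr 1
      rw [D.χ_sub, Circle.coe_div, D.χ_symm h]
      field_simp
    · simp
  · have : γ = h + α ↔ α = γ - h := by constructor <;> intro h <;> grind
    rw [if_congr this rfl rfl]
    split_ifs with h'
    · subst h'
      rw [smul_smul, add_sub_cancel, TYData.conj_χ]
      congr 1
      rw [D.χ_sub_left, Circle.coe_div]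
      field_simp
    · simp
  · have : (δ = h + β ∧ γ = h + α) ↔ (α - β = γ - δ ∧ -β = h - δ) := by
      constructor <;> intro h <;> grind
    rw [← ite_and, if_congr this rfl rfl]
    split_ifs with h'
    · rw [h'.1, show h + α - (h + β) = γ - δ by grind, show h + β = δ by grind]
    · rfl
  · simp only [smul_ite, smul_zero, Finset.sum_ite_eq', Finset.mem_univ, if_true, TYData.conj_χ,
      smul_smul]
    congr 1
    rw [D.χ_sub, Circle.coe_div]
    field_simp
  · split_ifs with h
    · subst h
      rw [smul_smul]
      congr 1
      rw [D.χ_sub, Circle.coe_div, D.χ_symm γ g]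
      field_simp
    · simp
  · split_ifs with h
    · subst h
      rw [smul_smul, TYData.conj_χ]
      congr 1
      rw [D.χ_sub_left, Circle.coe_div]
      field_simp
    · simp
  · rw [← ite_and]
    have : (β = δ ∧ α = γ) ↔ (α - β = γ - δ ∧ -β = -δ) := by
      constructor <;> intro h <;> grind
    rw [if_congr this rfl rfl]
    split_ifs with h'
    · rw [h'.1, show γ - g - (δ - g) = γ - δ by grind, show g - β = -(δ - g) by grind]
    · rfl
  · simp only [smul_ite, smul_zero, Finset.sum_ite_eq, Finset.mem_univ, if_true, Finset.smul_sum,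
      smul_smul]
    refine Finset.sum_congr rfl fun d _ => ?_
    rw [Finset.sum_ite_eq']
    simp [D.χ_add_left, mul_comm]
  · have : δ = h + β ↔ β = δ - h := by constructor <;> intro h <;> grind
    rw [if_congr this rfl rfl]
    split_ifs with h'
    · rw [show h + β - (g + h) = β - g by grind, show h + β = δ by grind]
    · rfl
  · have : γ = h + α ↔ α = γ - h := by constructor <;> intro h <;> grind
    rw [if_congr this rfl rfl]
    split_ifs with h'
    · rw [show h + α - (g + h) = α - g by grind, show h + α = γ by grind]
    · rfl
  · have : (δ = h + β ∧ γ = h + α) ↔ (α - β = γ - δ ∧ -β = h - δ) := by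
      constructor <;> intro h <;> grind
    rw [← ite_and, if_congr this rfl rfl]
    split_ifs with h'
    · rw [show h + α - (h + β) = α - β by grind, show g + h - (h + β) = g - β by grind,
        show h + β = δ by grind]
    · rfl


theorem tyMul_def (a b : TYAlg D) : a * b = ∑ x, ∑ α, ∑ β, ∑ y, ∑ γ, ∑ δ,
    (a x α β * b y γ δ) • tyTens D (tyCirc D x y α γ) (tyCirc D x y β δ) := rfl

theorem tyTheta_mul (a b : TYAlg D) : tyTheta D (a * b) = tyTheta D a * tyTheta D b := by
  have h : ∀ c : TYAlg D, tyTheta D c = ∑ x, ∑ α, ∑ β, c x α β • tyThetaF D x α β :=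
    fun c => rfl
  rw [h a, h b, tyMul_def]
  simp only [map_sum, map_smul, tyTheta_circ, Finset.sum_mul, smul_mul_assoc]
  simp only [Finset.mul_sum, mul_smul_comm, Finset.smul_sum, smul_smul]

theorem tyTheta_one : tyTheta D 1 = 1 := by
  have h1 : tyTheta D 1 = ∑ α : Option G, ∑ β : Option G, tyThetaF D (some 0) α β := by
    change tyTheta D (∑ α : Option G, ∑ β : Option G, tyF D (some 0) α β) = _
    simp only [map_sum, tyTheta_tyF]
  rw [h1, one_eq_sum_blockUnit]
  simp only [Fintype.sum_option, Fintype.sum_sum_type, tyThetaF, D.χ_zero_left, Circle.coe_one,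
    one_smul, sub_zero, zero_sub, Finset.sum_add_distrib]
  have h2 : ∑ x : G, ∑ x_1 : G, tyE (G := G) (some (x - x_1)) (some (-x_1)) (some (-x_1)) =
      ∑ d : G, ∑ y : G, tyE (some d) (some y) (some y) := by
    rw [Finset.sum_comm]
    rw [Finset.sum_comm (s := (Finset.univ : Finset G)) (f := fun d y : G =>
      tyE (G := G) (some d) (some y) (some y))]
    rw [← Equiv.sum_comp (Equiv.neg G)]
    refine Finset.sum_congr rfl fun y _ => ?_
    rw [← Equiv.sum_comp (Equiv.subRight y)]
    refine Finset.sum_congr rfl fun z _ => ?_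
    change tyE (some (z - y - -y)) (some (- -y)) (some (- -y)) = _
    rw [sub_neg_eq_add, sub_add_cancel, neg_neg]
  rw [h2]
  abel

theorem tyTheta_surjective : Function.Surjective (tyTheta D) := by
  rw [← LinearMap.range_eq_top, eq_top_iff]
  have hE : ∀ x y z, tyE (G := G) x y z ∈ LinearMap.range (tyTheta D) := by
    intro x y z
    have hs : ∀ (c : ℂ), c ≠ 0 → c • tyE (G := G) x y z ∈ LinearMap.range (tyTheta D) →
        tyE (G := G) x y z ∈ LinearMap.range (tyTheta D) := by
      intro c hc h
      have := Submodule.smul_mem _ c⁻¹ h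
      rwa [smul_smul, inv_mul_cancel₀ hc, one_smul] at this
    have hf : ∀ x α β, tyThetaF D x α β ∈ LinearMap.range (tyTheta D) :=
      fun x α β => ⟨_, tyTheta_tyF D x α β⟩
    rcases x with _ | d <;> rcases y with y | y <;> rcases z with z | z
    · have := hf (some (z - y)) (some z) none
      simpa [tyThetaF] using this
    · refine hs _ ?_ (hf none (Sum.inl y) (Sum.inr z))
      exact mul_ne_zero D.τ_ne (inv_ne_zero (Circle.coe_ne_zero _))
    · refine hs _ ?_ (hf none (Sum.inr z) (Sum.inl y))
      exact Circle.coe_ne_zero _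
    · have := hf (some (z - y)) none (some z)
      simpa [tyThetaF] using this
    · refine hs (Fintype.card G) (TYData.card_ne (G := G)) ⟨∑ g : G, (D.χ g d : ℂ)⁻¹ • tyF D (some g) none none, ?_⟩
      simp only [map_sum, map_smul, tyTheta_tyF, tyThetaF, Finset.smul_sum, smul_smul]
      rw [Finset.sum_comm]
      have key : ∀ y : G, ∑ x : G, ((D.χ x d : ℂ)⁻¹ * (D.χ x y : ℂ)) •
          tyE (G := G) (some y) none none =
          if y = d then (Fintype.card G : ℂ) • tyE (some d) none none else 0 := by
        intro y
        rw [← Finset.sum_smul]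
        have h2 : ∑ x : G, ((D.χ x d : ℂ)⁻¹ * (D.χ x y : ℂ)) = ∑ x : G, (D.χ (y - d) x : ℂ) := by
          refine Finset.sum_congr rfl fun x _ => ?_
          rw [D.χ_symm (y - d), D.χ_sub, Circle.coe_div]
          field_simp
        rw [h2, D.sum_χ, if_congr sub_eq_zero rfl rfl]
        split_ifs with h4
        · rw [h4]
        · simp
      rw [Finset.sum_congr rfl fun y _ => key y]
      simp
    · have := hf none (Sum.inr (d - z)) (Sum.inr (-z))
      simp only [tyThetaF] at this
      rwa [sub_neg_eq_add, sub_add_cancel, neg_neg] at this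
    · have := hf none (Sum.inl (d - y)) (Sum.inl (-y))
      simp only [tyThetaF] at this
      rwa [sub_neg_eq_add, sub_add_cancel, neg_neg] at this
    · have := hf (some (y - z)) (some (d - z)) (some (-z))
      simp only [tyThetaF] at this
      rwa [sub_neg_eq_add, sub_add_cancel, neg_neg, sub_neg_eq_add, sub_add_cancel] at this
  intro A _
  rw [sum_blockUnit A]
  exact Submodule.sum_mem _ fun x _ => Submodule.sum_mem _ fun y _ => Submodule.sum_mem _
    fun z _ => Submodule.smul_mem _ _ (hE x y z)

theorem tyTheta_injective : Function.Injective (tyTheta D) := by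
  have : Module.Finite ℂ (∀ x : Option G, Matrix (TYIdx G x) (TYIdx G x) ℂ) := inferInstance
  exact (LinearMap.injective_iff_surjective (K := ℂ)
    (f := (blockLin (tyThetaF D) : (∀ x : Option G, Matrix (TYIdx G x) (TYIdx G x) ℂ) →ₗ[ℂ] _))).mpr
    (tyTheta_surjective D)

noncomputable instance : Ring (TYAlg D) where
  left_distrib a b c := tyTheta_injective D (by simp only [tyTheta_mul, map_add, mul_add])
  right_distrib a b c := tyTheta_injective D (by simp only [tyTheta_mul, map_add, add_mul])
  zero_mul a := tyTheta_injective D (by simp only [tyTheta_mul, map_zero, zero_mul])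
  mul_zero a := tyTheta_injective D (by simp only [tyTheta_mul, map_zero, mul_zero])
  mul_assoc a b c := tyTheta_injective D (by simp only [tyTheta_mul, mul_assoc])
  one_mul a := tyTheta_injective D (by simp only [tyTheta_mul, tyTheta_one, one_mul])
  mul_one a := tyTheta_injective D (by simp only [tyTheta_mul, tyTheta_one, mul_one])
  neg_add_cancel := neg_add_cancel
  zsmul := zsmulRec

noncomputable instance : Algebra ℂ (TYAlg D) :=
  Algebra.ofModule
    (fun c a b => tyTheta_injective D (by simp only [tyTheta_mul, map_smul, smul_mul_assoc]))
    (fun c a b => tyTheta_injective D (by simp only [tyTheta_mul, map_smul, mul_smul_comm]))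

theorem tyThetaF_star (x : Option G) (α β : TYIdx G x) :
    tyTheta D (tyStarF D x α β) = star (tyThetaF D x α β) := by
  have hst : ∀ (c : ℂ) (M : ∀ x : Option G, Matrix (TYIdx G x) (TYIdx G x) ℂ),
      star (c • M) = starRingEnd ℂ c • star M := fun c M => star_smul c M
  have hχ : ∀ g d : G, D.χ (-g) d = (D.χ g d)⁻¹ := fun g d => by
    rw [D.χ_symm, D.χ_neg, D.χ_symm]
  rcases x with _ | g <;> rcases α with α | α <;> rcases β with β | β <;>
    simp only [tyStarF, tyThetaF, tyTheta_tyF, map_smul, hst, star_blockUnit, tyShift,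
      Option.map_none, Option.map_some, star_sum, smul_smul, TYData.conj_χ, map_mul, map_inv₀,
      Complex.conj_ofReal, inv_inv, hχ, Circle.coe_inv]
  · rw [inv_mul_cancel_left₀ D.τ_ne]
  · rw [sub_neg_eq_add, sub_add_cancel]
  · rw [sub_neg_eq_add, sub_add_cancel]
  · rw [show α - g - (β - g) = α - β by abel, show -g - (β - g) = -β by abel, neg_sub]

theorem tyStar_def (b : TYAlg D) :
    star b = ∑ x, ∑ α, ∑ β, (starRingEnd ℂ (b x α β)) • tyStarF D x α β := rfl

theorem tyTheta_star (b : TYAlg D) : tyTheta D (star b) = star (tyTheta D b) := by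
  have h : tyTheta D b = ∑ x, ∑ α, ∑ β, b x α β • tyThetaF D x α β := rfl
  rw [h, tyStar_def]
  simp only [map_sum, map_smul, tyThetaF_star, star_sum, star_smul]
  rfl

noncomputable instance : StarRing (TYAlg D) where
  star_involutive a := tyTheta_injective D (by simp only [tyTheta_star, star_star])
  star_mul a b := tyTheta_injective D (by simp only [tyTheta_star, tyTheta_mul, star_mul])
  star_add a b := tyTheta_injective D (by simp only [tyTheta_star, map_add, star_add])

instance : StarModule ℂ (TYAlg D) where
  star_smul c a := tyTheta_injective D (by simp only [tyTheta_star, map_smul, star_smul])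

theorem tyF_mul (x y : Option G) (α β : TYIdx G x) (γ δ : TYIdx G y) :
    tyF D x α β * tyF D y γ δ = tyTens D (tyCirc D x y α γ) (tyCirc D x y β δ) :=
  tyTheta_injective D (by rw [tyTheta_mul, tyTheta_tyF, tyTheta_tyF, tyTheta_circ])

theorem tyStar_tyF (x : Option G) (α β : TYIdx G x) : star (tyF D x α β) = tyStarF D x α β :=
  tyTheta_injective D (by rw [tyTheta_star, tyTheta_tyF, tyThetaF_star])

/-- `B` is isomorphic to a direct sum of full matrix algebras, as a `*`-algebra. -/
noncomputable def tyThetaHom :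
    TYAlg D →⋆ₐ[ℂ] (∀ x : Option G, Matrix (TYIdx G x) (TYIdx G x) ℂ) where
  toFun := tyTheta D
  map_one' := tyTheta_one D
  map_mul' := tyTheta_mul D
  map_zero' := map_zero _
  map_add' := map_add _
  commutes' c := by
    rw [Algebra.algebraMap_eq_smul_one, map_smul, tyTheta_one, ← Algebra.algebraMap_eq_smul_one]
  map_star' := tyTheta_star D

theorem tyComul_tyF (x : Option G) (α β : TYIdx G x) :
    CoalgebraStruct.comul (R := ℂ) (tyF D x α β) = ∑ γ, tyF D x α γ ⊗ₜ[ℂ] tyF D x γ β :=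
  tyLin_tyF D _ x α β

theorem tyCounit_tyF (x : Option G) (α β : TYIdx G x) :
    CoalgebraStruct.counit (R := ℂ) (tyF D x α β) = if α = β then (1 : ℂ) else 0 :=
  tyLin_tyF D _ x α β

noncomputable instance : Coalgebra ℂ (TYAlg D) where
  coassoc := by
    refine tyHom_ext D fun x α β => ?_
    simp only [LinearMap.comp_apply, tyComul_tyF, map_sum, LinearMap.rTensor_tmul,
      LinearMap.lTensor_tmul, TensorProduct.sum_tmul, TensorProduct.tmul_sum,
      LinearEquiv.coe_coe, TensorProduct.assoc_tmul]
    exact Finset.sum_comm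
  rTensor_counit_comp_comul := by
    refine tyHom_ext D fun x α β => ?_
    simp only [LinearMap.comp_apply, tyComul_tyF, map_sum, LinearMap.rTensor_tmul, tyCounit_tyF,
      TensorProduct.ite_tmul, TensorProduct.zero_tmul, TensorProduct.mk_apply]
    simp
  lTensor_counit_comp_comul := by
    refine tyHom_ext D fun x α β => ?_
    simp only [LinearMap.comp_apply, tyComul_tyF, map_sum, LinearMap.lTensor_tmul, tyCounit_tyF,
      TensorProduct.tmul_ite, TensorProduct.tmul_zero, LinearMap.flip_apply,
      TensorProduct.mk_apply]
    simp

theorem tyVec_sum (u : ∀ x, TYIdx G x → ℂ) : u = ∑ z, ∑ κ, u z κ • tyVec z κ := by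
  funext y i
  simp only [Finset.sum_apply, Pi.smul_apply]
  rw [Finset.sum_eq_single y]
  · rw [Finset.sum_eq_single i]
    · simp [tyVec]
    · intro j _ hj
      simp [tyVec, Ne.symm hj]
    · simp
  · intro z _ hz
    simp [tyVec, Ne.symm hz]
  · simp

theorem tyComul_tens (u w : ∀ x, TYIdx G x → ℂ) :
    CoalgebraStruct.comul (R := ℂ) (tyTens D u w) =
      ∑ z, ∑ κ, tyTens D u (tyVec z κ) ⊗ₜ[ℂ] tyTens D (tyVec z κ) w := by
  have h1 : ∀ (z : Option G) (κ : TYIdx G z), tyTens D u (tyVec z κ) = ∑ α, u z α • tyF D z α κ := by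
    intro z κ
    conv_lhs => rw [tyVec_sum u]
    simp only [tyTens_sum_left, tyTens_smul_left]
    rw [Finset.sum_eq_single z]
    · rfl
    · intro y _ hy
      refine Finset.sum_eq_zero fun i _ => ?_
      rcases y with _ | y <;> rcases z with _ | z
      · exact absurd rfl hy
      · rw [tyTens_none_some, smul_zero]
      · rw [tyTens_some_none, smul_zero]
      · rw [tyTens_vec_some, if_neg (fun h => hy (by rw [h])), smul_zero]
    · simp
  have h2 : ∀ (z : Option G) (κ : TYIdx G z), tyTens D (tyVec z κ) w =
      ∑ β, starRingEnd ℂ (w z β) • tyF D z κ β := by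
    intro z κ
    conv_lhs => rw [tyVec_sum w]
    simp only [tyTens_sum_right, tyTens_smul_right]
    rw [Finset.sum_eq_single z]
    · rfl
    · intro y _ hy
      refine Finset.sum_eq_zero fun i _ => ?_
      rcases y with _ | y <;> rcases z with _ | z
      · exact absurd rfl hy
      · rw [tyTens_some_none, smul_zero]
      · rw [tyTens_none_some, smul_zero]
      · rw [tyTens_vec_some, if_neg (fun h => hy (by rw [h])), smul_zero]
    · simp
  have h3 : CoalgebraStruct.comul (R := ℂ) (tyTens D u w) = ∑ z, ∑ α, ∑ β,
      (u z α * starRingEnd ℂ (w z β)) • ∑ γ, tyF D z α γ ⊗ₜ[ℂ] tyF D z γ β := rfl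
  rw [h3]
  refine Finset.sum_congr rfl fun z _ => ?_
  simp only [h1, h2, TensorProduct.sum_tmul, TensorProduct.tmul_sum, Finset.smul_sum,
    TensorProduct.smul_tmul', TensorProduct.tmul_smul, smul_smul]
  rw [Finset.sum_congr rfl fun α _ => Finset.sum_comm, Finset.sum_comm]
  refine Finset.sum_congr rfl fun γ _ => ?_
  rw [Finset.sum_comm]
  simp only [mul_comm]

/-- `J_{x,y}` is coisometric on the summands of `x ⊗ y`. -/
theorem tyCirc_coisometric (x y : Option G) (α : TYIdx G x) (γ : TYIdx G y)
    (w : ∀ x, TYIdx G x → ℂ) :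
    ∑ ε, ∑ ζ, tyTens D (tyCirc D x y α γ) (tyCirc D x y ε ζ) ⊗ₜ[ℂ] tyTens D (tyCirc D x y ε ζ) w =
      ∑ z, ∑ κ, tyTens D (tyCirc D x y α γ) (tyVec z κ) ⊗ₜ[ℂ] tyTens D (tyVec z κ) w := by
  have hsupp : ∀ (A : ∀ x, TYIdx G x → ℂ) (z : Option G) (κ : TYIdx G z), A z = 0 →
      tyTens D A (tyVec z κ) = 0 := by
    intro A z κ hA
    funext y
    ext i j
    change A y i * star (tyVec z κ y j) = 0
    by_cases hy : y = z
    · subst hy; simp [hA]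
    · simp [tyVec, hy]
  have hite : ∀ (p : Prop) [Decidable p] (a b : TYAlg D),
      (if p then a else 0) ⊗ₜ[ℂ] (if p then b else 0) = if p then a ⊗ₜ[ℂ] b else 0 := by
    intro p _ a b
    split_ifs <;> simp
  have hR : ∀ (A : ∀ x, TYIdx G x → ℂ) (z₀ : Option G), (∀ z, z ≠ z₀ → A z = 0) →
      ∑ z, ∑ κ, tyTens D A (tyVec z κ) ⊗ₜ[ℂ] tyTens D (tyVec z κ) w =
      ∑ κ, tyTens D A (tyVec z₀ κ) ⊗ₜ[ℂ] tyTens D (tyVec z₀ κ) w := by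
    intro A z₀ hA
    refine Finset.sum_eq_single z₀ (fun z _ hz => Finset.sum_eq_zero fun κ _ => ?_) (by simp)
    rw [hsupp A z κ (hA z hz), TensorProduct.zero_tmul]
  rcases x with _ | g <;> rcases y with _ | h
  · have hA : tyCirc D none none α γ none = 0 := by
      rcases α with α | α <;> rcases γ with γ | γ <;> simp only [tyCirc]
      · rfl
      · simp [tyVec]
      · split_ifs
        · simp [tyVec]
        · rfl
      · rfl
    generalize tyCirc D none none α γ = A at *
    have hN : ∑ κ : TYIdx G none, tyTens D A (tyVec none κ) ⊗ₜ[ℂ] tyTens D (tyVec none κ) w = 0 :=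
      Finset.sum_eq_zero fun κ _ => by rw [hsupp A none κ hA, TensorProduct.zero_tmul]
    rw [Fintype.sum_option, hN, zero_add]
    simp only [Fintype.sum_sum_type, Fintype.sum_option, tyCirc, tyTens_zero_right,
      TensorProduct.zero_tmul, Finset.sum_const_zero, zero_add, add_zero, tyTens_ite_right,
      tyTens_ite_left, tyTens_smul_left, tyTens_smul_right, tyTens_sum_left, tyTens_sum_right]
    rw [add_comm, Finset.sum_add_distrib]
    congr 1
    · simp only [hite, Finset.sum_ite_eq, Finset.mem_univ, if_true, Finset.smul_sum,
        TensorProduct.sum_tmul, TensorProduct.tmul_sum, TensorProduct.smul_tmul',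
        TensorProduct.tmul_smul, smul_smul, Complex.conj_ofReal, map_inv₀, TYData.conj_χ, inv_inv]
      rw [Finset.sum_comm]
      refine Finset.sum_congr rfl fun g _ => ?_
      rw [Finset.sum_comm]
      have key : ∀ y : G, ∑ x : G, (((D.τ : ℂ) * (D.χ g x : ℂ)⁻¹ * ((D.τ : ℂ) * (D.χ y x : ℂ))) •
          tyTens D A (tyVec (some y) none)) ⊗ₜ[ℂ] tyTens D (tyVec (some g) none) w =
          if y = g then tyTens D A (tyVec (some g) none) ⊗ₜ[ℂ] tyTens D (tyVec (some g) none) w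
            else 0 := by
        intro y
        rw [← TensorProduct.sum_tmul, ← Finset.sum_smul]
        have h2 : ∑ x : G, ((D.τ : ℂ) * (D.χ g x : ℂ)⁻¹ * ((D.τ : ℂ) * (D.χ y x : ℂ))) =
            D.τ * D.τ * ∑ x : G, (D.χ (y - g) x : ℂ) := by
          rw [Finset.mul_sum]
          refine Finset.sum_congr rfl fun x _ => ?_
          rw [D.χ_sub_left, Circle.coe_div]
          field_simp
        rw [h2, D.sum_χ, if_congr sub_eq_zero rfl rfl]
        split_ifs with h4
        · rw [D.τ_sq', one_smul, h4]
        · simp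
      rw [Finset.sum_congr rfl fun y _ => key y]
      simp
    · rw [Finset.sum_comm, Finset.sum_comm (s := (Finset.univ : Finset G))
        (f := fun x i : G => tyTens D A (tyVec (some x) (some i)) ⊗ₜ[ℂ]
          tyTens D (tyVec (some x) (some i)) w)]
      refine Finset.sum_congr rfl fun k _ => ?_
      rw [← Equiv.sum_comp (Equiv.subLeft k) (fun x => tyTens D A (tyVec (some x) (some k)) ⊗ₜ[ℂ]
          tyTens D (tyVec (some x) (some k)) w)]
      rfl
  · have hA : ∀ z, z ≠ none → tyCirc D none (some h) α γ z = 0 := by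
      intro z hz
      rcases α with α | α <;> simp only [tyCirc] <;> split_ifs <;> simp [tyVec, hz]
    generalize tyCirc D none (some h) α γ = A at *
    rw [hR A none hA]
    simp only [Fintype.sum_sum_type, Fintype.sum_option, tyCirc, tyTens_zero_right,
      TensorProduct.zero_tmul, Finset.sum_const_zero, zero_add, add_zero, tyTens_ite_right,
      tyTens_ite_left, tyTens_smul_left, tyTens_smul_right, tyTens_sum_left, tyTens_sum_right,
      reduceCtorEq, if_true, if_false, Option.some.injEq, hite, Finset.sum_ite_eq,
      Finset.sum_ite_eq', Finset.mem_univ, TensorProduct.smul_tmul',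
      TensorProduct.tmul_smul, smul_smul, TYData.conj_χ]
    have h1 : ∀ x, (D.χ h x : ℂ) * (D.χ h x : ℂ)⁻¹ = 1 :=
      fun x => mul_inv_cancel₀ (Circle.coe_ne_zero _)
    simp only [h1, one_smul]
    congr 1
    exact Equiv.sum_comp (Equiv.addLeft h) (fun x => tyTens D A (tyVec none (Sum.inr x)) ⊗ₜ[ℂ]
      tyTens D (tyVec none (Sum.inr x)) w)
  · have hA : ∀ z, z ≠ none → tyCirc D (some g) none α γ z = 0 := by
      intro z hz
      rcases γ with γ | γ <;> simp only [tyCirc] <;> split_ifs <;> simp [tyVec, hz]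
    generalize tyCirc D (some g) none α γ = A at *
    rw [hR A none hA]
    simp only [Fintype.sum_sum_type, Fintype.sum_option, tyCirc, tyTens_zero_right,
      TensorProduct.zero_tmul, Finset.sum_const_zero, zero_add, add_zero, tyTens_ite_right,
      tyTens_ite_left, tyTens_smul_left, tyTens_smul_right, tyTens_sum_left, tyTens_sum_right,
      reduceCtorEq, if_true, if_false, Option.some.injEq, hite, Finset.sum_ite_eq,
      Finset.sum_ite_eq', Finset.mem_univ, TensorProduct.smul_tmul',
      TensorProduct.tmul_smul, smul_smul, TYData.conj_χ]
    have h1 : ∀ x, (D.χ g x : ℂ) * (D.χ g x : ℂ)⁻¹ = 1 :=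
      fun x => mul_inv_cancel₀ (Circle.coe_ne_zero _)
    simp only [h1, one_smul]
    rw [add_comm]
    congr 1
    exact Equiv.sum_comp (Equiv.subRight g) (fun x => tyTens D A (tyVec none (Sum.inl x)) ⊗ₜ[ℂ]
      tyTens D (tyVec none (Sum.inl x)) w)
  · have hA : ∀ z, z ≠ some (g + h) → tyCirc D (some g) (some h) α γ z = 0 := by
      intro z hz
      rcases α with _ | α <;> simp only [tyCirc] <;> split_ifs <;> simp [tyVec, hz]
    generalize tyCirc D (some g) (some h) α γ = A at *
    rw [hR A (some (g + h)) hA]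
    simp only [Fintype.sum_sum_type, Fintype.sum_option, tyCirc, tyTens_zero_right,
      TensorProduct.zero_tmul, Finset.sum_const_zero, zero_add, add_zero, tyTens_ite_right,
      tyTens_ite_left, tyTens_smul_left, tyTens_smul_right, tyTens_sum_left, tyTens_sum_right,
      reduceCtorEq, if_true, if_false, Option.some.injEq, hite, Finset.sum_ite_eq,
      Finset.sum_ite_eq', Finset.mem_univ, TensorProduct.smul_tmul',
      TensorProduct.tmul_smul, smul_smul, TYData.conj_χ]
    congr 1
    exact Equiv.sum_comp (Equiv.addLeft h) (fun x => tyTens D A (tyVec (some (g + h)) (some x)) ⊗ₜ[ℂ]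
      tyTens D (tyVec (some (g + h)) (some x)) w)

theorem tyBilin_ext {M : Type*} [AddCommGroup M] [Module ℂ M]
    {φ ψ : TYAlg D →ₗ[ℂ] TYAlg D →ₗ[ℂ] M}
    (h : ∀ x y α β γ δ, φ (tyF D x α β) (tyF D y γ δ) = ψ (tyF D x α β) (tyF D y γ δ)) : φ = ψ :=
  tyHom_ext D fun x α β => tyHom_ext D fun y γ δ => h x y α β γ δ

theorem tyComul_mul (a b : TYAlg D) : CoalgebraStruct.comul (R := ℂ) (a * b) =
    CoalgebraStruct.comul (R := ℂ) a * CoalgebraStruct.comul (R := ℂ) b := by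
  have : (LinearMap.mul ℂ (TYAlg D)).compr₂ (CoalgebraStruct.comul (R := ℂ)) =
      (LinearMap.mul ℂ (TYAlg D ⊗[ℂ] TYAlg D)).compl₁₂ (CoalgebraStruct.comul (R := ℂ))
        (CoalgebraStruct.comul (R := ℂ)) := by
    refine tyBilin_ext D fun x y α β γ δ => ?_
    simp only [LinearMap.compr₂_apply, LinearMap.compl₁₂_apply, LinearMap.mul_apply', tyComul_tyF,
      tyF_mul, tyComul_tens, Finset.sum_mul, Finset.mul_sum, Algebra.TensorProduct.tmul_mul_tmul]
    rw [← tyCirc_coisometric]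
    exact Finset.sum_comm
  exact LinearMap.congr_fun (LinearMap.congr_fun this a) b

/-- The source of the arrow `v^x_α`. -/
def tySrc : ∀ x : Option G, TYIdx G x → Option G
  | some g, α => tyShift α g
  | none, Sum.inl k => some k
  | none, Sum.inr _ => none

/-- The target of the arrow `v^x_α`. -/
def tyTgt : ∀ x : Option G, TYIdx G x → Option G
  | some _, α => α
  | none, Sum.inl _ => none
  | none, Sum.inr k => some k

theorem tyVec_tgt (x z : Option G) (α : TYIdx G x) (ρ : TYIdx G z)
    (h : tyTgt z ρ ≠ tyTgt x α) : tyVec x α z ρ = 0 := by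
  by_cases hz : z = x
  · subst hz
    have : ρ ≠ α := by rintro rfl; exact h rfl
    simp [tyVec, this]
  · simp [tyVec, hz]

/-- The vectors supported on the arrows with target `t`. -/
def tyTgtSub (t : Option G) : Submodule ℂ (∀ x, TYIdx G x → ℂ) where
  carrier := {u | ∀ z ρ, tyTgt z ρ ≠ t → u z ρ = 0}
  zero_mem' := fun _ _ _ => rfl
  add_mem' {u v} hu hv z ρ h := by
    change u z ρ + v z ρ = 0
    rw [hu z ρ h, hv z ρ h, add_zero]
  smul_mem' c u hu z ρ h := by
    change c * u z ρ = 0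
    rw [hu z ρ h, mul_zero]

theorem tyCirc_tgt (x y : Option G) (α : TYIdx G x) (γ : TYIdx G y) :
    tyCirc D x y α γ ∈ tyTgtSub (tyTgt y γ) := by
  have hv : ∀ (x : Option G) (α : TYIdx G x) (t : Option G), tyTgt x α = t →
      tyVec x α ∈ tyTgtSub t := by
    rintro x α t rfl z ρ h
    exact tyVec_tgt x z α ρ h
  have hs : ∀ (c : ℂ) (x : Option G) (α : TYIdx G x) (t : Option G), tyTgt x α = t →
      c • tyVec x α ∈ tyTgtSub t := fun c x α t h => Submodule.smul_mem _ c (hv x α t h)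
  have hi : ∀ (p : Prop) [Decidable p] (t : Option G) (u : ∀ x, TYIdx G x → ℂ),
      (p → u ∈ tyTgtSub t) → (if p then u else 0) ∈ tyTgtSub t := by
    intro p _ t u h
    split_ifs with hp
    · exact h hp
    · exact Submodule.zero_mem _
  rcases x with _ | g <;> rcases y with _ | k <;> rcases α with α | α <;>
    rcases γ with γ | γ <;> simp only [tyCirc]
  · exact Submodule.zero_mem _
  · exact hv _ _ _ rfl
  · exact hi _ _ _ fun _ => Submodule.smul_mem _ _ (Submodule.sum_mem _ fun i _ => hs _ _ _ _ rfl)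
  · exact Submodule.zero_mem _
  all_goals
    refine hi _ _ _ fun h => ?_
    first
    | (refine hs _ _ _ _ ?_; simp_all [tyTgt])
    | (refine hv _ _ _ ?_; simp_all [tyTgt])

theorem tyCounit_mul (x y : Option G) (α β : TYIdx G x) (γ δ : TYIdx G y) :
    CoalgebraStruct.counit (R := ℂ) (tyF D x α β * tyF D y γ δ) =
      if α = β ∧ γ = δ ∧ tyTgt x α = tySrc y γ then (1 : ℂ) else 0 := by
  rw [tyF_mul]
  rcases x with _ | g <;> rcases y with _ | h <;> rcases α with α | α <;>
    rcases β with β | β <;> rcases γ with γ | γ <;> rcases δ with δ | δ <;>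
    simp only [tyCirc, tyTens_ite_left, tyTens_ite_right, tyTens_smul_left,
      tyTens_smul_right, tyTens_sum_left, tyTens_sum_right, tyTens_vec_some, tyTens_some_none,
      tyTens_none_some, tyTens_none, tyTens_zero_left, tyTens_zero_right,
      apply_ite (CoalgebraStruct.counit (R := ℂ) (A := TYAlg D)), map_smul, map_sum, map_zero,
      tyCounit_tyF, smul_zero, mul_zero, tyTgt, tySrc, tyShift, Option.map_some, Option.map_none,
      zero_mul, Finset.sum_mul, Finset.mul_sum, reduceCtorEq, if_false, if_true,
      Option.some.injEq, Sum.inl.injEq, Sum.inr.injEq, and_false, false_and,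
      Finset.sum_const_zero, ite_self, and_true, true_and]
  · have : (γ - α = δ - β ∧ γ = δ) ↔ (α = β ∧ γ = δ) := by constructor <;> intro h <;> grind
    rw [← ite_and, if_congr this rfl rfl]
  · by_cases h : β = δ
    · subst h
      by_cases h' : α = γ
      · subst h'
        simp only [if_true, smul_ite, smul_zero, Finset.sum_ite_eq', Finset.sum_ite_eq,
          Finset.mem_univ, smul_eq_mul, mul_one, mul_ite, mul_zero, Complex.conj_ofReal, map_inv₀, TYData.conj_χ,
          inv_inv, and_true]
        have h2 : ∑ x : G, (D.χ x β : ℂ) * ((D.τ : ℂ) * (D.χ x α : ℂ)⁻¹) =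
            D.τ * ∑ x : G, (D.χ (β - α) x : ℂ) := by
          rw [Finset.mul_sum]
          refine Finset.sum_congr rfl fun x _ => ?_
          rw [D.χ_symm (β - α), D.χ_sub, Circle.coe_div]
          field_simp
        rw [h2, D.sum_χ, if_congr (sub_eq_zero.trans eq_comm) rfl rfl, ← mul_assoc]
        have h3 := D.τ_sq'
        split_ifs <;> simp_all
      · have : ¬ (α = β ∧ γ = β ∧ α = γ) := fun h => h' h.2.2
        simp [h', this]
    · have : ¬ (α = β ∧ γ = δ ∧ α = γ) := by rintro ⟨rfl, rfl, rfl⟩; exact h rfl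
      simp only [if_neg h, if_neg this]
  · split_ifs with h'
    · subst h'
      simp [TYData.conj_χ]
    · simp
  · have : (δ = h + β ∧ γ = h + α ∧ h + α = h + β) ↔ (α = β ∧ γ = δ ∧ α = γ - h) := by
      constructor <;> intro h <;> grind
    rw [← ite_and, ← ite_and, if_congr (and_assoc.trans this) rfl rfl]
  · split_ifs with h'
    · subst h'
      simp [TYData.conj_χ]
    · simp
  · have : (β = δ ∧ α = γ ∧ γ - g = δ - g) ↔ (α = β ∧ γ = δ ∧ α = γ) := by
      constructor <;> intro h <;> grind
    rw [← ite_and, ← ite_and, if_congr (and_assoc.trans this) rfl rfl]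
  · have : (δ = h + β ∧ γ = h + α ∧ h + α = h + β) ↔ (α = β ∧ γ = δ ∧ α = γ - h) := by
      constructor <;> intro h <;> grind
    rw [← ite_and, ← ite_and, if_congr (and_assoc.trans this) rfl rfl]

theorem tyCounit_tens (u w : ∀ x, TYIdx G x → ℂ) :
    CoalgebraStruct.counit (R := ℂ) (tyTens D u w) =
      ∑ z, ∑ ρ, u z ρ * starRingEnd ℂ (w z ρ) := by
  have : CoalgebraStruct.counit (R := ℂ) (tyTens D u w) =
      ∑ z, ∑ ρ, ∑ σ, (u z ρ * starRingEnd ℂ (w z σ)) • (if ρ = σ then (1 : ℂ) else 0) := rfl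
  rw [this]
  simp

theorem ty_counit_mul_mul (x y z : Option G) (α β : TYIdx G x) (γ δ : TYIdx G y)
    (ρ σ : TYIdx G z) :
    CoalgebraStruct.counit (R := ℂ) (tyF D x α β * tyF D y γ δ * tyF D z ρ σ) =
      if (α = β ∧ γ = δ ∧ tyTgt x α = tySrc y γ) ∧ ρ = σ ∧ tyTgt y γ = tySrc z ρ
        then (1 : ℂ) else 0 := by
  have h1 := tyCounit_mul D x y α β γ δ
  rw [tyF_mul] at h1 ⊢
  have hu := tyCirc_tgt D x y α γ
  generalize tyCirc D x y α γ = u at *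
  generalize tyCirc D x y β δ = w at *
  rw [tyCounit_tens] at h1
  have h2 : tyTens D u w = ∑ z, ∑ ρ, ∑ σ, (u z ρ * starRingEnd ℂ (w z σ)) • tyF D z ρ σ :=
    ty_sum D (tyTens D u w)
  rw [h2]
  simp only [Finset.sum_mul, smul_mul_assoc, map_sum, map_smul, tyCounit_mul]
  have h3 : (if (α = β ∧ γ = δ ∧ tyTgt x α = tySrc y γ) ∧ ρ = σ ∧ tyTgt y γ = tySrc z ρ
        then (1 : ℂ) else 0) = (∑ z, ∑ ρ, u z ρ * starRingEnd ℂ (w z ρ)) *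
        (if ρ = σ ∧ tyTgt y γ = tySrc z ρ then (1 : ℂ) else 0) := by
    rw [h1, ite_and]
    split_ifs <;> simp
  rw [h3, Finset.sum_mul]
  refine Finset.sum_congr rfl fun x' _ => ?_
  rw [Finset.sum_mul]
  refine Finset.sum_congr rfl fun ρ' _ => ?_
  simp only [smul_eq_mul, ite_and, mul_ite, mul_one, mul_zero, Finset.sum_ite_eq, Finset.mem_univ,
    if_true]
  by_cases ht : tyTgt x' ρ' = tyTgt y γ
  · rw [ht]
  · rw [hu x' ρ' ht]
    simp

theorem tyAntipodeF_eq (x : Option G) (α β : TYIdx G x) :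
    tyAntipodeF D x α β = tyStarF D x β α := by
  rcases x with _ | g
  · rcases α with α | α <;> rcases β with β | β <;> rfl
  · rfl

/-- The antipode of `B`. -/
noncomputable def tyAntipode : TYAlg D →ₗ[ℂ] TYAlg D := tyLin D (tyAntipodeF D)

theorem tyAntipode_tyF (x : Option G) (α β : TYIdx G x) :
    tyAntipode D (tyF D x α β) = star (tyF D x β α) := by
  rw [tyStar_tyF, ← tyAntipodeF_eq]
  exact tyLin_tyF D _ x α β

theorem tyAntipode_tens (u w : ∀ x, TYIdx G x → ℂ) :
    tyAntipode D (tyTens D u w) = star (tyTens D w u) := by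
  have h1 : tyAntipode D (tyTens D u w) =
      ∑ z, ∑ ρ, ∑ σ, (u z ρ * starRingEnd ℂ (w z σ)) • tyAntipodeF D z ρ σ := rfl
  have h2 : star (tyTens D w u) =
      ∑ z, ∑ ρ, ∑ σ, starRingEnd ℂ (w z ρ * starRingEnd ℂ (u z σ)) • tyStarF D z ρ σ := rfl
  rw [h1, h2]
  refine Finset.sum_congr rfl fun z _ => ?_
  rw [Finset.sum_comm]
  simp only [map_mul, Complex.conj_conj, tyAntipodeF_eq, mul_comm]

theorem tyAntipode_mul (a b : TYAlg D) :
    tyAntipode D (a * b) = tyAntipode D b * tyAntipode D a := by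
  have : (LinearMap.mul ℂ (TYAlg D)).compr₂ (tyAntipode D) =
      ((LinearMap.mul ℂ (TYAlg D)).flip).compl₁₂ (tyAntipode D) (tyAntipode D) := by
    refine tyBilin_ext D fun x y α β γ δ => ?_
    simp only [LinearMap.compr₂_apply, LinearMap.compl₁₂_apply, LinearMap.mul_apply',
      LinearMap.flip_apply, tyAntipode_tyF]
    rw [← star_mul, tyF_mul, tyF_mul, tyAntipode_tens]
  exact LinearMap.congr_fun (LinearMap.congr_fun this a) b

theorem tyOne_def : (1 : TYAlg D) = ∑ α : Option G, ∑ β : Option G, tyF D (some 0) α β := rfl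

theorem tyAntipode_one : tyAntipode D 1 = 1 := by
  have : tyAntipode D 1 = star 1 := by
    rw [tyOne_def]
    simp only [star_sum, map_sum, tyAntipode_tyF]
    exact Finset.sum_comm
  rw [this, star_one]

theorem tyShift_bijective (g : G) : Function.Bijective (fun α : Option G => tyShift α g) := by
  refine ⟨fun a b h => ?_, fun b => ⟨tyShift b (-g), ?_⟩⟩
  · rcases a with _ | a <;> rcases b with _ | b <;> simp_all [tyShift]
  · rcases b with _ | b <;> simp [tyShift]

theorem tyComul_starF (x : Option G) (α β : TYIdx G x) :
    CoalgebraStruct.comul (R := ℂ) (tyStarF D x α β) =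
      ∑ γ, tyStarF D x α γ ⊗ₜ[ℂ] tyStarF D x γ β := by
  rcases x with _ | g
  · rcases α with α | α <;> rcases β with β | β <;>
      simp only [tyStarF, Fintype.sum_sum_type, map_smul, tyComul_tyF, TensorProduct.smul_tmul',
        TensorProduct.tmul_smul, smul_smul, mul_inv_cancel₀ D.τ_ne, inv_mul_cancel₀ D.τ_ne,
        one_smul, smul_add, Finset.smul_sum, add_comm]
  · simp only [tyStarF, tyComul_tyF]
    exact (Function.Bijective.sum_comp (tyShift_bijective g) (fun γ : Option G =>
      tyF D (some (-g)) (tyShift α g) γ ⊗ₜ[ℂ] tyF D (some (-g)) γ (tyShift β g))).symm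

theorem tyCounit_starF (x : Option G) (α β : TYIdx G x) :
    CoalgebraStruct.counit (R := ℂ) (tyStarF D x α β) = if α = β then (1 : ℂ) else 0 := by
  rcases x with _ | g
  · rcases α with α | α <;> rcases β with β | β <;>
      simp [tyStarF, map_smul, tyCounit_tyF]
  · simp only [tyStarF, tyCounit_tyF]
    exact if_congr (tyShift_bijective g).injective.eq_iff rfl rfl

theorem tyComul_star (b : TYAlg D) : CoalgebraStruct.comul (R := ℂ) (star b) =
    star (CoalgebraStruct.comul (R := ℂ) b) := by
  rw [ty_sum D b]
  simp only [star_sum, star_smul, map_sum, map_smul, tyStar_tyF, tyComul_starF, tyComul_tyF,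
    TensorProduct.star_tmul]

theorem tyComul_antipode (b : TYAlg D) : CoalgebraStruct.comul (R := ℂ) (tyAntipode D b) =
    TensorProduct.map (tyAntipode D) (tyAntipode D)
      (TensorProduct.comm ℂ _ _ (CoalgebraStruct.comul (R := ℂ) b)) := by
  rw [ty_sum D b]
  simp only [map_sum, map_smul, tyAntipode_tyF, tyStar_tyF, tyComul_starF, tyComul_tyF,
    TensorProduct.comm_tmul, TensorProduct.map_tmul]

theorem tyCounit_antipode (b : TYAlg D) :
    CoalgebraStruct.counit (R := ℂ) (tyAntipode D b) = CoalgebraStruct.counit (R := ℂ) b := by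
  rw [ty_sum D b]
  simp only [map_sum, map_smul, tyAntipode_tyF, tyStar_tyF, tyCounit_starF, tyCounit_tyF, eq_comm]

theorem tyComul_one : CoalgebraStruct.comul (R := ℂ) (1 : TYAlg D) =
    ∑ α : Option G, ∑ β : Option G, ∑ γ : Option G,
      tyF D (some 0) α γ ⊗ₜ[ℂ] tyF D (some 0) γ β := by
  rw [tyOne_def]
  simp only [map_sum, tyComul_tyF]

theorem tyF_zero_mul_zero (α β γ δ : Option G) :
    tyF D (some 0) α β * tyF D (some 0) γ δ =
      if α = γ ∧ β = δ then tyF D (some 0) α β else 0 := by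
  rw [tyF_mul]
  have h : ∀ α γ : Option G, tyCirc D (some 0) (some 0) α γ =
      if α = γ then tyVec (some 0) α else 0 := by
    intro α γ
    rcases α with _ | α <;> rcases γ with _ | γ <;> simp only [tyCirc, reduceCtorEq, if_true,
      if_false, Option.some.injEq]
    · rw [add_zero]
    · rw [zero_add, zero_add]
      exact if_congr eq_comm rfl rfl
  rw [h, h, tyTens_ite_left, tyTens_ite_right, ite_and]
  rfl

theorem tensor_units_mul {B κ : Type*} [Ring B] [Algebra ℂ B] [Fintype κ] [DecidableEq κ]
    (e : κ → κ → B)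
    (he : ∀ a b c d, e a b * e c d = if a = c ∧ b = d then e a b else 0) :
    ((∑ a, ∑ b, ∑ c, e a c ⊗ₜ[ℂ] e c b) ⊗ₜ[ℂ] (1 : B)) *
      (TensorProduct.assoc ℂ B B B).symm ((1 : B) ⊗ₜ[ℂ] (∑ a, ∑ b, ∑ c, e a c ⊗ₜ[ℂ] e c b)) =
    ∑ a, ∑ b, ∑ c, (∑ d, e a d ⊗ₜ[ℂ] e d c) ⊗ₜ[ℂ] e c b := by
  simp only [TensorProduct.sum_tmul, TensorProduct.tmul_sum, map_sum, TensorProduct.assoc_symm_tmul]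
  simp only [Finset.sum_mul]
  simp only [Finset.mul_sum]
  simp only [Algebra.TensorProduct.tmul_mul_tmul, mul_one, one_mul,
    he, TensorProduct.tmul_ite, TensorProduct.ite_tmul, TensorProduct.tmul_zero,
    TensorProduct.zero_tmul]
  refine Finset.sum_congr rfl fun a _ => ?_
  have h : ∀ b c : κ, ∑ a' : κ, ∑ b' : κ, ∑ c' : κ,
      (if c = a' ∧ b = c' then (e a c ⊗ₜ[ℂ] e c b) ⊗ₜ[ℂ] e c' b' else 0) =
      ∑ b' : κ, (e a c ⊗ₜ[ℂ] e c b) ⊗ₜ[ℂ] e b b' := by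
    intro b c
    rw [Finset.sum_eq_single c (fun a' _ ha' => by simp [Ne.symm ha']) (by simp)]
    simp
  simp only [h]
  rw [Finset.sum_congr rfl fun b _ => Finset.sum_comm, Finset.sum_comm]

theorem tyComul_one_axiom :
    (CoalgebraStruct.comul (R := ℂ) (1 : TYAlg D) ⊗ₜ[ℂ] (1 : TYAlg D)) *
      (TensorProduct.assoc ℂ (TYAlg D) (TYAlg D) (TYAlg D)).symm
        ((1 : TYAlg D) ⊗ₜ[ℂ] CoalgebraStruct.comul (R := ℂ) (1 : TYAlg D)) =
    TensorProduct.map CoalgebraStruct.comul LinearMap.id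
      (CoalgebraStruct.comul (R := ℂ) (1 : TYAlg D)) := by
  rw [tyComul_one]
  refine (tensor_units_mul (fun a b : Option G => tyF D (some 0) a b)
    (tyF_zero_mul_zero D)).trans ?_
  simp only [map_sum, TensorProduct.map_tmul, tyComul_tyF, LinearMap.id_apply]

theorem tyTargetCounital_tyF (x : Option G) (α β : TYIdx G x) :
    targetCounital (TYAlg D) (tyF D x α β) =
      if α = β then ∑ γ : Option G, tyF D (some 0) (tySrc x α) γ else 0 := by
  change TensorProduct.lid ℂ (TYAlg D) (TensorProduct.map Coalgebra.counit LinearMap.id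
    (CoalgebraStruct.comul (R := ℂ) (1 : TYAlg D) * (tyF D x α β ⊗ₜ[ℂ] (1 : TYAlg D)))) = _
  rw [tyComul_one]
  simp only [Finset.sum_mul, Algebra.TensorProduct.tmul_mul_tmul, map_sum, TensorProduct.map_tmul,
    tyCounit_mul, LinearMap.id_apply, TensorProduct.lid_tmul, mul_one, ite_smul, one_smul,
    zero_smul]
  have h : ∀ a : Option G, ∑ b : Option G, ∑ c : Option G,
      (if a = c ∧ α = β ∧ tyTgt (some (0 : G)) a = tySrc x α then tyF D (some 0) c b else 0) =
      if a = tySrc x α then (if α = β then ∑ b : Option G, tyF D (some 0) a b else 0) else 0 := by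
    intro a
    rw [Finset.sum_comm, Finset.sum_eq_single a (fun c _ hc => by simp [Ne.symm hc]) (by simp)]
    simp only [tyTgt]
    split_ifs <;> simp_all
  simp only [h]
  simp

theorem tySourceCounital_tyF (x : Option G) (α β : TYIdx G x) :
    sourceCounital (TYAlg D) (tyF D x α β) =
      if α = β then ∑ γ : Option G, tyF D (some 0) γ (tyTgt x α) else 0 := by
  change TensorProduct.rid ℂ (TYAlg D) (TensorProduct.map LinearMap.id Coalgebra.counit
    (((1 : TYAlg D) ⊗ₜ[ℂ] tyF D x α β) * CoalgebraStruct.comul (R := ℂ) (1 : TYAlg D))) = _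
  rw [tyComul_one]
  simp only [Finset.mul_sum, Algebra.TensorProduct.tmul_mul_tmul, map_sum, TensorProduct.map_tmul,
    tyCounit_mul, LinearMap.id_apply, TensorProduct.rid_tmul, one_mul, ite_smul, one_smul,
    zero_smul]
  have h : ∀ a : Option G, ∑ b : Option G, ∑ c : Option G,
      (if α = β ∧ c = b ∧ tyTgt x α = tySrc (some (0 : G)) c then tyF D (some 0) a c else 0) =
      (if α = β then tyF D (some 0) a (tyTgt x α) else 0) := by
    intro a
    have hs : ∀ c : Option G, tySrc (some (0 : G)) c = c := by
      intro c
      rcases c with _ | c <;> simp [tySrc, tyShift]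
    simp only [hs]
    rw [Finset.sum_eq_single (tyTgt x α) (fun b _ hb => ?_) (by simp)]
    · rw [Finset.sum_eq_single (tyTgt x α) (fun c _ hc => by simp [hc]) (by simp)]
      simp
    · refine Finset.sum_eq_zero fun c _ => if_neg ?_
      rintro ⟨-, rfl, h⟩
      exact hb h.symm
  simp only [h]
  split_ifs <;> simp

theorem tyCirc_neg (g : G) (α β : Option G) :
    tyCirc D (some g) (some (-g)) α (tyShift β g) =
      if α = β then tyVec (some 0) (tyShift α g) else 0 := by
  rcases α with _ | α <;> rcases β with _ | β <;>
    simp only [tyCirc, tyShift, Option.map_some, Option.map_none, reduceCtorEq, if_true, if_false,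
      Option.some.injEq]
  · rw [add_neg_cancel]
  · have : β - g = -g + α ↔ α = β := by constructor <;> intro h <;> grind
    rw [if_congr this rfl rfl, add_neg_cancel, neg_add_eq_sub]

theorem tyCirc_neg' (g : G) (α β : Option G) :
    tyCirc D (some (-g)) (some g) (tyShift α g) β =
      if α = β then tyVec (some 0) α else 0 := by
  rcases α with _ | α <;> rcases β with _ | β <;>
    simp only [tyCirc, tyShift, Option.map_some, Option.map_none, reduceCtorEq, if_true, if_false,
      Option.some.injEq]
  · rw [neg_add_cancel]
  · have : β = g + (α - g) ↔ α = β := by constructor <;> intro h <;> grind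
    rw [if_congr this rfl rfl, neg_add_cancel, add_sub_cancel]

theorem ty_sum_collapse {M : Type*} [AddCommGroup M] [Module ℂ M] (F : G → M) :
    ∑ x : G, ∑ g : G, ((D.τ : ℂ) * D.τ * (D.χ g x : ℂ)) • F g = F 0 := by
  rw [Finset.sum_comm]
  have key : ∀ g : G, ∑ x : G, ((D.τ : ℂ) * D.τ * (D.χ g x : ℂ)) • F g =
      if g = 0 then F 0 else 0 := by
    intro g
    rw [← Finset.sum_smul, ← Finset.mul_sum, D.sum_χ]
    split_ifs with h
    · rw [D.τ_sq', one_smul, h]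
    · simp
  rw [Finset.sum_congr rfl fun g _ => key g]
  simp

theorem ty_sum_collapse' {M : Type*} [AddCommGroup M] [Module ℂ M] (F : G → M) :
    ∑ x : G, ∑ g : G, ((D.τ : ℂ) * D.τ * (D.χ g x : ℂ)⁻¹) • F g = F 0 := by
  rw [← Equiv.sum_comp (Equiv.neg G)]
  rw [← ty_sum_collapse D F]
  refine Finset.sum_congr rfl fun x _ => Finset.sum_congr rfl fun g _ => ?_
  change ((D.τ : ℂ) * D.τ * (D.χ g (-x) : ℂ)⁻¹) • F g = _
  rw [D.χ_neg, Circle.coe_inv, inv_inv]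

theorem tyMul_antipode_right (x : Option G) (α β : TYIdx G x) :
    ∑ γ, tyF D x α γ * star (tyF D x β γ) = targetCounital (TYAlg D) (tyF D x α β) := by
  rw [tyTargetCounital_tyF]
  simp only [tyStar_tyF]
  rcases x with _ | g
  · rcases α with α | α <;> rcases β with β | β <;>
      simp only [tyStarF, Fintype.sum_sum_type, mul_smul_comm, tyF_mul, tyCirc, tySrc,
      tyTens_ite_left, tyTens_ite_right, tyTens_smul_left,
      tyTens_smul_right, tyTens_sum_left, tyTens_sum_right, tyTens_vec_some, tyTens_some_none,
      tyTens_none_some, tyTens_none, tyTens_zero_left, tyTens_zero_right, Finset.sum_const_zero,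
      reduceCtorEq, Sum.inl.injEq, Sum.inr.injEq, if_true, if_false, Fintype.sum_option,
      sub_self, smul_ite, smul_zero, add_zero, zero_add]
    · by_cases h : α = β
      · subst h
        have hd : α - α = 0 := sub_self α
        generalize α - α = d at hd ⊢
        subst hd
        simp only [if_true, Finset.sum_ite_eq, Finset.mem_univ, D.χ_zero_left, Circle.coe_one,
          inv_one, map_one, one_smul, Complex.conj_ofReal, smul_smul, Finset.sum_const,
          Finset.card_univ]
        rw [add_comm, ← Nat.cast_smul_eq_nsmul ℂ, smul_smul, mul_comm, D.τ_sq', one_smul]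
      · have : β - α ≠ 0 := fun h' => h (sub_eq_zero.mp h').symm
        have h3 : ∑ x : G, (D.χ (β - α) x : ℂ) = 0 := by rw [D.sum_χ, if_neg this]
        simp only [this, h, if_false, Finset.sum_const_zero, zero_add, map_inv₀,
          Finset.sum_ite_eq, Finset.mem_univ, if_true,
          TYData.conj_χ, inv_inv]
        rw [← Finset.smul_sum, ← Finset.smul_sum, ← Finset.sum_smul, h3]
        simp
    · by_cases h : α = β
      · subst h
        simp only [if_true, Finset.sum_ite_eq', Finset.sum_ite_eq, Finset.mem_univ, smul_ite,
          smul_zero, D.χ_zero_left, Circle.coe_one, inv_one, one_smul, smul_smul,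
          inv_mul_cancel₀ D.τ_ne, map_inv₀, TYData.conj_χ, inv_inv, Complex.conj_ofReal,
          Finset.smul_sum]
        rw [add_comm]
        congr 1
        have := ty_sum_collapse D (fun g => (D.χ g α : ℂ)⁻¹ • tyF D (some g) none none)
        simp only [D.χ_zero_left, Circle.coe_one, inv_one, one_smul, smul_smul] at this
        rw [← this]
        refine Finset.sum_congr rfl fun x _ => Finset.sum_congr rfl fun g _ => ?_
        congr 1
        ring
      · simp [h]
  · simp only [tyStarF, tyF_mul, tyCirc_neg, tySrc, tyTens_ite_left, tyTens_ite_right, if_true]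
    split_ifs with h
    · rw [← Function.Bijective.sum_comp (tyShift_bijective g)
        (fun γ : Option G => tyF D (some 0) (tyShift α g) γ)]
      rfl
    · simp

theorem tyMul_antipode_left (x : Option G) (α β : TYIdx G x) :
    ∑ γ, star (tyF D x γ α) * tyF D x γ β = sourceCounital (TYAlg D) (tyF D x α β) := by
  rw [tySourceCounital_tyF]
  simp only [tyStar_tyF]
  rcases x with _ | g
  · rcases α with α | α <;> rcases β with β | β <;>
      simp only [tyStarF, Fintype.sum_sum_type, smul_mul_assoc, tyF_mul, tyCirc, tyTgt,
      tyTens_ite_left, tyTens_ite_right, tyTens_smul_left,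
      tyTens_smul_right, tyTens_sum_left, tyTens_sum_right, tyTens_vec_some, tyTens_some_none,
      tyTens_none_some, tyTens_none, tyTens_zero_left, tyTens_zero_right, Finset.sum_const_zero,
      reduceCtorEq, Sum.inl.injEq, Sum.inr.injEq, if_true, if_false, Fintype.sum_option,
      sub_self, smul_ite, smul_zero, add_zero, zero_add]
    · by_cases h : α = β
      · subst h
        have h0 : ∀ x d : G, d = 0 → tyF D (some d) (some x) none =
          tyF D (some 0) (some x) none := by rintro x d rfl; rfl
        simp only [if_true, Finset.sum_ite_eq', Finset.sum_ite_eq, Finset.mem_univ, smul_ite,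
          smul_zero, D.χ_zero_left, Circle.coe_one, inv_one, one_smul, smul_smul, map_one,
          inv_mul_cancel₀ D.τ_ne, map_inv₀, TYData.conj_χ, inv_inv, Complex.conj_ofReal,
          Finset.smul_sum, h0 _ _ (sub_self _)]
        congr 1
        have := ty_sum_collapse' D (fun g => (D.χ g α : ℂ) • tyF D (some g) none none)
        simp only [D.χ_zero_left, Circle.coe_one, inv_one, one_smul, smul_smul] at this
        rw [← this]
        refine Finset.sum_congr rfl fun x _ => Finset.sum_congr rfl fun g _ => ?_
        congr 1
        ring
      · simp [h]
    · by_cases h : α = β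
      · subst h
        have h0 : ∀ x d : G, d = 0 → tyF D (some d) (some x) (some α) =
          tyF D (some 0) (some x) (some α) := by rintro x d rfl; rfl
        simp only [if_true, Finset.sum_ite_eq', Finset.mem_univ, sub_self, D.χ_zero_left,
          Circle.coe_one, inv_one, one_smul, smul_smul, Finset.sum_const,
          Finset.card_univ, h0 _ _ (sub_self _)]
        congr 1
        rw [← Nat.cast_smul_eq_nsmul ℂ, smul_smul, mul_comm, D.τ_sq', one_smul]
      · have : β - α ≠ 0 := fun h' => h (sub_eq_zero.mp h').symm
        have h3 : ∑ x : G, ((D.χ (β - α) x : ℂ))⁻¹ = 0 := by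
          have h4 : ∀ x : G, ((D.χ (β - α) x : ℂ))⁻¹ = (D.χ (α - β) x : ℂ) := by
            intro x
            rw [← neg_sub β α, D.χ_symm (-(β - α)), D.χ_neg, D.χ_symm x, Circle.coe_inv]
          simp only [h4]
          rw [D.sum_χ, if_neg (fun h' => h (sub_eq_zero.mp h'))]
        simp only [Ne.symm this, h, if_false, Finset.sum_const_zero, add_zero, Finset.sum_ite_eq',
          Finset.mem_univ, if_true]
        rw [← Finset.smul_sum, ← Finset.smul_sum, ← Finset.sum_smul, h3]
        simp
  · simp only [tyStarF, tyF_mul, tyCirc_neg', tyTgt, tyTens_ite_left, tyTens_ite_right, if_true]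
    split_ifs with h
    · subst h
      rfl
    · simp

noncomputable instance : WeakHopfCStarAlgebra (TYAlg D) where
  finite := by
    have : Module.Finite ℂ (∀ x : Option G, Matrix (TYIdx G x) (TYIdx G x) ℂ) := inferInstance
    exact this
  exists_faithful := by
    obtain ⟨N, φ, hφ⟩ := block_exists_faithful (ι := Option G) (n := TYIdx G)
    exact ⟨N, φ.comp (tyThetaHom D), hφ.comp (tyTheta_injective D)⟩
  comul_mul := tyComul_mul D
  counit_mul b c d := by
    have hc : LinearMap.mul' ℂ ℂ ∘ₗ TensorProduct.map
        (Coalgebra.counit (R := ℂ) (A := TYAlg D) ∘ₗ LinearMap.mulLeft ℂ b)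
        (Coalgebra.counit (R := ℂ) (A := TYAlg D) ∘ₗ LinearMap.mulRight ℂ d) ∘ₗ Coalgebra.comul =
        Coalgebra.counit (R := ℂ) (A := TYAlg D) ∘ₗ LinearMap.mulRight ℂ d ∘ₗ
          LinearMap.mulLeft ℂ b := by
      refine tyHom_ext D fun y γ δ => ?_
      simp only [LinearMap.comp_apply, tyComul_tyF, map_sum, TensorProduct.map_tmul,
        LinearMap.mul'_apply, LinearMap.mulLeft_apply, LinearMap.mulRight_apply]
      have hb : ∑ ε, (Coalgebra.counit (R := ℂ) (tyF D y ε δ * d)) •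
          (Coalgebra.counit (R := ℂ) (A := TYAlg D) ∘ₗ LinearMap.mulRight ℂ (tyF D y γ ε)) =
          Coalgebra.counit (R := ℂ) (A := TYAlg D) ∘ₗ LinearMap.mulRight ℂ (tyF D y γ δ * d) := by
        refine tyHom_ext D fun x α β => ?_
        simp only [LinearMap.sum_apply, LinearMap.smul_apply, LinearMap.comp_apply,
          LinearMap.mulRight_apply, smul_eq_mul]
        have hd : ∑ ε, (Coalgebra.counit (R := ℂ) (tyF D x α β * tyF D y γ ε)) •
            (Coalgebra.counit (R := ℂ) (A := TYAlg D) ∘ₗ LinearMap.mulLeft ℂ (tyF D y ε δ)) =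
            Coalgebra.counit (R := ℂ) (A := TYAlg D) ∘ₗ
              LinearMap.mulLeft ℂ (tyF D x α β * tyF D y γ δ) := by
          refine tyHom_ext D fun z ρ σ => ?_
          simp only [LinearMap.sum_apply, LinearMap.smul_apply, LinearMap.comp_apply,
            LinearMap.mulLeft_apply, smul_eq_mul, ty_counit_mul_mul, tyCounit_mul]
          rw [Finset.sum_eq_single γ (fun ε _ hε => by simp [Ne.symm hε]) (by simp)]
          by_cases h : γ = δ
          · subst h
            by_cases h1 : α = β
            · subst h1
              by_cases h2 : ρ = σ
              · subst h2
                by_cases h3 : tyTgt x α = tySrc y γ <;> by_cases h4 : tyTgt y γ = tySrc z ρ <;>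
                  simp [h3, h4]
              · simp [h2]
            · simp [h1]
          · simp [h]
        have := LinearMap.congr_fun hd d
        simp only [LinearMap.sum_apply, LinearMap.smul_apply, LinearMap.comp_apply,
            LinearMap.mulLeft_apply, smul_eq_mul] at this
        rw [← mul_assoc, ← this]
        exact Finset.sum_congr rfl fun _ _ => mul_comm _ _
      have := LinearMap.congr_fun hb b
      simp only [LinearMap.sum_apply, LinearMap.smul_apply, LinearMap.comp_apply,
          LinearMap.mulRight_apply, smul_eq_mul] at this
      rw [mul_assoc, ← this]
      exact Finset.sum_congr rfl fun _ _ => mul_comm _ _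
    exact LinearMap.congr_fun hc c
  comul_one := tyComul_one_axiom D
  antipode := tyAntipode D
  antipode_one := tyAntipode_one D
  antipode_mul := tyAntipode_mul D
  counit_antipode := tyCounit_antipode D
  comul_antipode := tyComul_antipode D
  mul_antipode_right b := by
    rw [ty_sum D b]
    simp only [map_sum, map_smul]
    refine Finset.sum_congr rfl fun x _ => Finset.sum_congr rfl fun α _ =>
      Finset.sum_congr rfl fun β _ => ?_
    congr 1
    rw [← tyMul_antipode_right]
    refine (congrArg _ (congrArg _ (tyComul_tyF D x α β))).trans ?_
    simp only [map_sum, TensorProduct.map_tmul, LinearMap.mul'_apply, tyAntipode_tyF,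
      LinearMap.id_apply]
  mul_antipode_left b := by
    rw [ty_sum D b]
    simp only [map_sum, map_smul]
    refine Finset.sum_congr rfl fun x _ => Finset.sum_congr rfl fun α _ =>
      Finset.sum_congr rfl fun β _ => ?_
    congr 1
    rw [← tyMul_antipode_left]
    refine (congrArg _ (congrArg _ (tyComul_tyF D x α β))).trans ?_
    simp only [map_sum, TensorProduct.map_tmul, LinearMap.mul'_apply, tyAntipode_tyF,
      LinearMap.id_apply]
  comul_star := tyComul_star D

/-! ## The quantum subgroupoids attached to the subgroups of `G` -/

noncomputable instance tySubFintype (L : AddSubgroup G) : Fintype L := Fintype.ofFinite L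

/-- The C*-algebra `B_L = ⨁ l ∈ L, B(H^l)`; for `l ∈ L`, the space `H^l` has dimension `|G| + 1`,
with basis indexed by `Ω = G ⊔ {m}`. -/
def TYSub (_D : TYData G) (L : AddSubgroup G) : Type u :=
  ∀ _ : L, Matrix (Option G) (Option G) ℂ

variable (L : AddSubgroup G)

noncomputable instance : Ring (TYSub D L) :=
  inferInstanceAs (Ring (∀ _ : L, Matrix (Option G) (Option G) ℂ))

noncomputable instance : Algebra ℂ (TYSub D L) :=
  inferInstanceAs (Algebra ℂ (∀ _ : L, Matrix (Option G) (Option G) ℂ))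

noncomputable instance : StarRing (TYSub D L) :=
  inferInstanceAs (StarRing (∀ _ : L, Matrix (Option G) (Option G) ℂ))

instance : StarModule ℂ (TYSub D L) :=
  inferInstanceAs (StarModule ℂ (∀ _ : L, Matrix (Option G) (Option G) ℂ))

/-- The matrix unit `e^l_{y,z}` of `B_L`. -/
noncomputable def tySubE (l : L) (y z : Option G) : TYSub D L :=
  blockUnit (n := fun _ : L => Option G) l y z

/-- The linear map on `B_L` sending `e^l_{y,z}` to `F l y z`. -/
noncomputable def tySubLin {M : Type*} [AddCommGroup M] [Module ℂ M]
    (F : L → Option G → Option G → M) : TYSub D L →ₗ[ℂ] M :=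
  blockLin (n := fun _ : L => Option G) F

/-- `Δ_L(e^l_{y,z}) = ∑ e^{l₁}_{y-l₂,z-l₂} ⊗ e^{l₂}_{y,z}` over `l₁, l₂ ∈ L` with `l₁ + l₂ = l`. -/
noncomputable def tySubComul : TYSub D L →ₗ[ℂ] TYSub D L ⊗[ℂ] TYSub D L :=
  tySubLin D L fun l y z => ∑ l₂ : L,
    tySubE D L (l - l₂) (tyShift y l₂) (tyShift z l₂) ⊗ₜ[ℂ] tySubE D L l₂ y z

/-- `ε_L(e^l_{y,z}) = δ_{l,0}`. -/
noncomputable def tySubCounit : TYSub D L →ₗ[ℂ] ℂ :=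
  tySubLin D L fun l _ _ => if l = 0 then 1 else 0

/-- `S_L(e^l_{y,z}) = e^{-l}_{z-l,y-l}`. -/
noncomputable def tySubAntipode : TYSub D L →ₗ[ℂ] TYSub D L :=
  tySubLin D L fun l y z => tySubE D L (-l) (tyShift z l) (tyShift y l)

/-- The canonical projection `π_L : B → B_L`, `π_L(e^x_{α,β}) = e^x_{α,β}` if `x ∈ L` and `0`
otherwise. -/
noncomputable def tyProj : TYAlg D →⋆ₐ[ℂ] TYSub D L where
  toFun b := fun l => tyTheta D b (some (l : G))
  map_one' := by rw [tyTheta_one]; rfl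
  map_mul' a b := by rw [tyTheta_mul]; rfl
  map_zero' := by rw [map_zero]; rfl
  map_add' a b := by rw [map_add]; rfl
  commutes' c := by
    have := (tyThetaHom D).toAlgHom.commutes c
    change tyTheta D (algebraMap ℂ (TYAlg D) c) = _ at this
    rw [this]
    rfl
  map_star' a := by rw [tyTheta_star]; rfl

theorem tyProj_surjective : Function.Surjective (tyProj D L) := by
  classical
  intro c
  obtain ⟨b, hb⟩ := tyTheta_surjective D (fun x => match x with
    | some g => if h : g ∈ L then c ⟨g, h⟩ else 0
    | none => 0)
  refine ⟨b, ?_⟩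
  funext l
  change tyTheta D b (some (l : G)) = c l
  rw [hb]
  simp

open Classical in
/-- The matrix unit `e^d_{y,z}` of `B_L`, which is `0` if `d ∉ L`. -/
noncomputable def tySubE0 (d : G) (y z : Option G) : TYSub D L :=
  if h : d ∈ L then tySubE D L ⟨d, h⟩ y z else 0

theorem tySubE0_coe (l : L) (y z : Option G) : tySubE0 D L l y z = tySubE D L l y z := by
  simp [tySubE0]

theorem tySubLin_E {M : Type*} [AddCommGroup M] [Module ℂ M]
    (F : L → Option G → Option G → M) (l : L) (y z : Option G) :
    tySubLin D L F (tySubE D L l y z) = F l y z :=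
  blockLin_unit (n := fun _ : L => Option G) F l y z

theorem tySubComul_E0 (d : G) (y z : Option G) :
    tySubComul D L (tySubE0 D L d y z) = ∑ j : G,
      tySubE0 D L (d - j) (tyShift y j) (tyShift z j) ⊗ₜ[ℂ] tySubE0 D L j y z := by
  by_cases h : d ∈ L
  · have : tySubE0 D L d y z = tySubE D L ⟨d, h⟩ y z := by simp [tySubE0, h]
    rw [this]
    refine (tySubLin_E D L _ _ _ _).trans ?_
    refine Fintype.sum_of_injective (fun l : L => (l : G)) Subtype.val_injective _ _ ?_ ?_
    · intro j hj
      have : j ∉ L := fun hj' => hj ⟨⟨j, hj'⟩, rfl⟩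
      simp [tySubE0, this]
    · intro l
      rw [← tySubE0_coe, ← tySubE0_coe]
      rfl
  · have : tySubE0 D L d y z = 0 := by simp [tySubE0, h]
    rw [this, map_zero, Finset.sum_eq_zero]
    intro j _
    by_cases hj : j ∈ L
    · have : d - j ∉ L := fun h' => h (by simpa using L.add_mem h' hj)
      simp [tySubE0, this]
    · simp [tySubE0, hj]

theorem tySubCounit_E0 (d : G) (y z : Option G) :
    tySubCounit D L (tySubE0 D L d y z) = if d = 0 then 1 else 0 := by
  by_cases h : d ∈ L
  · have : tySubE0 D L d y z = tySubE D L ⟨d, h⟩ y z := by simp [tySubE0, h]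
    rw [this]
    refine (tySubLin_E D L _ _ _ _).trans ?_
    exact if_congr (by rw [Subtype.ext_iff]; rfl) rfl rfl
  · have h0 : d ≠ 0 := by rintro rfl; exact h L.zero_mem
    simp [tySubE0, h, h0]

theorem tySubAntipode_E0 (d : G) (y z : Option G) :
    tySubAntipode D L (tySubE0 D L d y z) =
      tySubE0 D L (-d) (tyShift z d) (tyShift y d) := by
  by_cases h : d ∈ L
  · have : tySubE0 D L d y z = tySubE D L ⟨d, h⟩ y z := by simp [tySubE0, h]
    rw [this]
    refine (tySubLin_E D L _ _ _ _).trans ?_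
    rw [← tySubE0_coe]
    rfl
  · simp [tySubE0, h]

/-- The values of the canonical projection on the basis of `B`. -/
noncomputable def tyProjF : ∀ x : Option G, TYIdx G x → TYIdx G x → TYSub D L
  | some g, some h, some k => tySubE0 D L (h - k) (some (g - k)) (some (-k))
  | some g, none, none => ∑ d : G, (D.χ g d : ℂ) • tySubE0 D L d none none
  | some _, some _, none => 0
  | some _, none, some _ => 0
  | none, Sum.inl h, Sum.inl k => tySubE0 D L (h - k) (some (-k)) none
  | none, Sum.inr h, Sum.inr k => tySubE0 D L (h - k) none (some (-k))
  | none, Sum.inl _, Sum.inr _ => 0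
  | none, Sum.inr _, Sum.inl _ => 0

theorem tyE_restrict (d : G) (y z : Option G) :
    (fun l : L => tyE (G := G) (some d) y z (some (l : G))) = tySubE0 D L d y z := by
  by_cases h : d ∈ L
  · have : tySubE0 D L d y z = tySubE D L ⟨d, h⟩ y z := by simp [tySubE0, h]
    rw [this]
    funext l
    by_cases hl : l = ⟨d, h⟩
    · subst hl
      funext i j
      exact (blockUnit_apply_apply (n := TYIdx G) (some d) y z i j).trans
        (blockUnit_apply_apply (n := fun _ : L => Option G) ⟨d, h⟩ y z i j).symm
    · have h' : (some (l : G)) ≠ some d := fun h' => hl (Subtype.ext (by simpa using h'))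
      exact (blockUnit_apply_ne (n := TYIdx G) h' y z).trans
        (blockUnit_apply_ne (n := fun _ : L => Option G) hl y z).symm
  · have h0 : tySubE0 D L d y z = 0 := by simp [tySubE0, h]
    rw [h0]
    funext l
    have h' : (some (l : G)) ≠ some d := by
      intro h'
      exact h (Option.some.inj h' ▸ l.2)
    exact blockUnit_apply_ne (n := TYIdx G) h' y z

theorem tyE_restrict_none (y z : G ⊕ G) :
    (fun l : L => tyE (G := G) none y z (some (l : G))) = 0 := by
  funext l
  exact blockUnit_apply_ne (n := TYIdx G) (Option.some_ne_none _) y z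

theorem tyProj_tyF (x : Option G) (α β : TYIdx G x) :
    tyProj D L (tyF D x α β) = tyProjF D L x α β := by
  change (fun l : L => tyTheta D (tyF D x α β) (some (l : G))) = _
  rw [tyTheta_tyF]
  have hsm : ∀ (c : ℂ) (A : ∀ x : Option G, Matrix (TYIdx G x) (TYIdx G x) ℂ),
      (fun l : L => (c • A) (some (l : G))) = c • (fun l : L => A (some (l : G))) :=
    fun _ _ => rfl
  rcases x with _ | g <;> rcases α with α | α <;> rcases β with β | β <;>
    simp only [tyThetaF, tyProjF]
  · exact tyE_restrict D L _ _ _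
  · rw [hsm, tyE_restrict_none, smul_zero]; rfl
  · rw [hsm, tyE_restrict_none, smul_zero]; rfl
  · exact tyE_restrict D L _ _ _
  · have : (fun l : L => (∑ d : G, (D.χ g d : ℂ) • tyE (G := G) (some d) none none) (some (l : G)))
        = ∑ d : G, (D.χ g d : ℂ) • (fun l : L => tyE (G := G) (some d) none none (some (l : G))) := by
      funext l
      simp only [Finset.sum_apply, Pi.smul_apply]
    rw [this]
    exact Finset.sum_congr rfl fun d _ => congrArg _ (tyE_restrict D L _ _ _)
  · exact tyE_restrict_none L _ _
  · exact tyE_restrict_none L _ _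
  · exact tyE_restrict D L _ _ _

theorem tyProj_comul (b : TYAlg D) : tySubComul D L (tyProj D L b) =
    TensorProduct.map (tyProj D L).toAlgHom.toLinearMap (tyProj D L).toAlgHom.toLinearMap
      (Coalgebra.comul (R := ℂ) b) := by
  have : tySubComul D L ∘ₗ (tyProj D L).toAlgHom.toLinearMap =
    TensorProduct.map (tyProj D L).toAlgHom.toLinearMap (tyProj D L).toAlgHom.toLinearMap ∘ₗ
      Coalgebra.comul := by
    refine tyHom_ext D fun x α β => ?_
    have hp : ∀ x α β, (tyProj D L).toAlgHom.toLinearMap (tyF D x α β) = tyProjF D L x α β :=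
      tyProj_tyF D L
    simp only [LinearMap.comp_apply, tyComul_tyF, map_sum, TensorProduct.map_tmul, hp]
    have e1 : ∀ a b j : G, a - (j + b) = a - b - j := fun a b j => by abel
    have e2 : ∀ b j : G, -(j + b) = -b - j := fun b j => by abel
    rcases x with _ | g <;> rcases α with α | α <;> rcases β with β | β <;>
      simp only [tyProjF, Fintype.sum_option, Fintype.sum_sum_type, map_zero,
        TensorProduct.tmul_zero, TensorProduct.zero_tmul, zero_add, add_zero,
        Finset.sum_const_zero, tySubComul_E0, tyShift, Option.map_some, Option.map_none, map_sum,
        map_smul]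
    · refine Fintype.sum_equiv (Equiv.addRight β) _ _ fun j => ?_
      rw [Equiv.coe_addRight, e1, e2, add_sub_cancel_right]
    · refine Fintype.sum_equiv (Equiv.addRight β) _ _ fun j => ?_
      rw [Equiv.coe_addRight, e1, e2, add_sub_cancel_right]
    · rw [TensorProduct.sum_tmul]
      simp only [TensorProduct.tmul_sum, Finset.smul_sum]
      rw [Finset.sum_comm]
      conv_rhs => rw [Finset.sum_comm]
      refine Finset.sum_congr rfl fun j _ => ?_
      refine Fintype.sum_equiv (Equiv.subRight j) _ _ fun x => ?_
      rw [Equiv.subRight_apply, TensorProduct.smul_tmul_smul, ← Circle.coe_mul, ← D.χ_add,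
        sub_add_cancel]
    · refine Fintype.sum_equiv (Equiv.addRight β) _ _ fun j => ?_
      rw [Equiv.coe_addRight, e1, e1, e2, add_sub_cancel_right]
  exact LinearMap.congr_fun this b

theorem tyProj_counit (b : TYAlg D) :
    tySubCounit D L (tyProj D L b) = Coalgebra.counit (R := ℂ) b := by
  have : tySubCounit D L ∘ₗ (tyProj D L).toAlgHom.toLinearMap = Coalgebra.counit := by
    refine tyHom_ext D fun x α β => ?_
    have hp : ∀ x α β, (tyProj D L).toAlgHom.toLinearMap (tyF D x α β) = tyProjF D L x α β :=
      tyProj_tyF D L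
    simp only [LinearMap.comp_apply, tyCounit_tyF, hp]
    rcases x with _ | g <;> rcases α with α | α <;> rcases β with β | β <;>
      simp [tyProjF, tySubCounit_E0, sub_eq_zero, D.χ_zero]
  exact LinearMap.congr_fun this b

theorem tyProj_antipode (b : TYAlg D) : tySubAntipode D L (tyProj D L b) =
    tyProj D L (WeakHopfCStarAlgebra.antipode b) := by
  have : tySubAntipode D L ∘ₗ (tyProj D L).toAlgHom.toLinearMap =
      (tyProj D L).toAlgHom.toLinearMap ∘ₗ tyAntipode D := by
    refine tyHom_ext D fun x α β => ?_
    have hp : ∀ x α β, (tyProj D L).toAlgHom.toLinearMap (tyF D x α β) = tyProjF D L x α β :=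
      tyProj_tyF D L
    simp only [LinearMap.comp_apply, hp, tyAntipode_tyF, tyStar_tyF]
    rcases x with _ | g <;> rcases α with α | α <;> rcases β with β | β <;>
      simp only [tyProjF, tyStarF, map_smul, hp, smul_zero, map_zero, tyShift, Option.map_some,
        Option.map_none, tySubAntipode_E0, map_sum, neg_sub]
    · rw [show -β - (α - β) = -α by abel]
    · rw [show -β - (α - β) = -α by abel]
    · refine Fintype.sum_equiv (Equiv.neg G) _ _ fun x => ?_
      rw [Equiv.neg_apply, D.χ_symm (-g) (-x), D.χ_neg, D.χ_symm (-x) g, D.χ_neg, inv_inv]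
    · rw [show -β - (α - β) = -α by abel, show g - β - (α - β) = g - α by abel,
        show β - g - (α - g) = β - α by abel, show -g - (α - g) = -α by abel]
  exact LinearMap.congr_fun this b

noncomputable instance : Coalgebra ℂ (TYSub D L) :=
  coalgebraOfSurjective (tyProj D L).toAlgHom (tyProj_surjective D L) (tySubComul D L)
    (tySubCounit D L) (tyProj_comul D L) (tyProj_counit D L)

noncomputable instance : WeakHopfCStarAlgebra (TYSub D L) :=
  weakHopfOfSurjective (tyProj D L) (tyProj_surjective D L) (tySubAntipode D L)
    (block_exists_faithful (ι := L) (n := fun _ => Option G))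
    (tyProj_comul D L) (tyProj_counit D L) (tyProj_antipode D L)

/-- The quantum subgroupoid `(𝔊^L, π_L)`. -/
noncomputable def tySubgroupoid : QuantumSubgroupoid (TYAlg D) where
  C := TYSub D L
  π :=
    { toStarAlgHom := tyProj D L
      map_comul := tyProj_comul D L
      map_antipode := tyProj_antipode D L
      map_counit := tyProj_counit D L }
  surjective := tyProj_surjective D L

/-! ## The coideals -/

/-- The subspace `X ⊗ H̄^x` of `B`, for a subspace `X` of `H^x`. -/
noncomputable def tyTensSub (x : Option G) (X : Submodule ℂ (TYIdx G x → ℂ)) :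
    Submodule ℂ (TYAlg D) :=
  Submodule.span ℂ {b | ∃ v ∈ X, ∃ w : TYIdx G x → ℂ,
    b = tyTens D (Pi.single x v) (Pi.single x w)}

/-- The annihilator `L^⊥ = {g ∈ G | χ(g, l) = 1 for all l ∈ L}`. -/
def tyPerp : Set G := {g | ∀ l ∈ L, D.χ g l = 1}

open Classical in
/-- The vector `v^0_Y = ∑ y ∈ Y, v^0_y` of `H^0`, for a coset `Y ∈ G/L`. -/
noncomputable def tyCosetVec (Y : G ⧸ L) : TYIdx G (some 0) → ℂ :=
  ∑ y : G, if (QuotientAddGroup.mk y : G ⧸ L) = Y then Pi.single (some y) 1 else 0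

/-- The vector `v^l_m` of `H^l`, for `l ∈ G`. -/
noncomputable def tyVecM (l : G) : TYIdx G (some l) → ℂ :=
  Pi.single none 1

/-- The summands `Vec⟨v^0_Y, Y ∈ G/L⟩ ⊗ H̄^0` (for `none`) and `v^l_m ⊗ H̄^l` (for
`l ∈ L^⊥`). -/
noncomputable def tySummand : Option (tyPerp D L) → Submodule ℂ (TYAlg D)
  | none => tyTensSub D (some 0) (Submodule.span ℂ (Set.range (tyCosetVec L)))
  | some l => tyTensSub D (some (l : G)) (Submodule.span ℂ {tyVecM (l : G)})

end TY

/-! Write `b = ∑ b^x_{α,β} f^x_{α,β}`, let `t(α)` be the target `tyTgt x α` of `v^x_α`, and let `E_σ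
= ∑ η, f^0_{η,σ}` (`tySourceElt`). The proof turns the equation defining the coideal into linear
equations for the coordinates of `b`.

Since `v^x_α ∘ v^0_γ` is `v^x_α` if `γ = t(α)` and `0` otherwise, right multiplication by `Δ(1)` is
diagonal: `(1 ⊗ f^x_{α,β})Δ(1) = E_{t(α)} ⊗ f^x_{α,β}` (`tyF_tmul_comul_one`). Comparing the
coefficients of `f^x_{γ,β}` in the second leg, `b` lies in the coideal of `(H, π)` iff `∑ α,
b^x_{α,β} π(f^x_{α,γ}) = b^x_{γ,β} π(E_{t(γ)})` for all `x, γ, β` (`mem_tyCoideal_iff`). Equations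
with different `x` or different `β` do not interact, so the coideal has the form `⨁ x, X_x ⊗ H̄^x`,
and only the spaces `X_x` of admissible columns have to be found.

For `π = id` the `f^x_{α,γ}` are linearly independent. If `x ≠ 0` the two sides lie in different
blocks and `X_x = 0`; if `x = 0` the equation says that the column is constant. Thus the coideal is
the span of the `E_σ`, which is also the image of `ε_s` (`sourceSubalgebra_eq_span`).

For `π = π_L` one compares matrix units `e^l_{y,z}` with `l ∈ L` (`mem_tyCoideal_sub_iff`). The
right-hand side is always diagonal: `π_L(E_k)` is a sum of units at position `(-k, -k)`, and
`π_L(E_m)` one at position `(m, m)`. In block `m` the left-hand side is off-diagonal, so `X_m = 0`.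
In block `g`, column `γ = k ∈ G`, it sits at `(g - k, -k)`: the coordinate at `k` vanishes if `g ≠
0`, while for `g = 0` the coordinates at `h` and `k` agree whenever `h - k ∈ L`. In block `g`, `γ =
m`, the coordinate `b_m` satisfies `b_m χ(g, l) = b_m` for all `l ∈ L`, so it is free if `g ∈ L^⊥`
and zero otherwise. Hence `X_0` consists of the `L`-invariant functions on `G`, spanned by the
`v^0_Y`, together with `v^0_m`; and for `l ∈ L^⊥`, `l ≠ 0`, the space `X_l` is spanned by `v^l_m`.
The sum is direct because its summands occupy disjoint sets of rows `(x, α)`. -/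

section TYCoideals

set_option linter.unusedSectionVars false

variable {G : Type u} [AddCommGroup G] [Fintype G] [DecidableEq G] (D : TYData G)

/-! ### The coideal condition in coordinates -/

/-- The sum of the `v^0_γ` is a right unit, and `v^0_γ` acts on `v^x_α` as the projection onto
arrows with target `γ`. -/
theorem tyCirc_zero_right (x : Option G) (α : TYIdx G x) (γ : Option G) :
    tyCirc D x (some 0) α γ = if γ = tyTgt x α then tyVec x α else 0 := by
  rcases x with _ | g <;> rcases α with α | α <;> rcases γ with _ | γ <;>
    simp [tyCirc, tyTgt, D.χ_zero_left]
  all_goals rw [add_zero]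

/-- The element `∑ η, f^0_{η,σ}` of `B_s`. -/
noncomputable def tySourceElt (σ : Option G) : TYAlg D :=
  ∑ η : Option G, tyF D (some 0) η σ

/-- The product with a single `f^0_{γ,δ}` tests both `γ = t(α)` and `δ = t(β)`. Exactly one `δ`
passes the second test, so after summation over `δ` only the test on the first index remains. -/
theorem tyF_mul_sum_zero (x : Option G) (α β : TYIdx G x) (γ : Option G) :
    ∑ δ : Option G, tyF D x α β * tyF D (some 0) γ δ =
      if γ = tyTgt x α then tyF D x α β else 0 := by
  simp only [tyF_mul, tyCirc_zero_right, tyTens_ite_left, tyTens_ite_right]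
  rw [Finset.sum_eq_single (tyTgt x β) (fun δ _ hδ => by simp [hδ]) (by simp)]
  simp [tyF]

/-- In `Δ(1) = ∑ f^0_{η,γ} ⊗ f^0_{γ,δ}` the sum over `δ` acts on `f^x_{α,β}` as a projection that
only `γ = t(α)` survives. What is left in the first leg is `∑ η, f^0_{η,t(α)}`. -/
theorem tyF_tmul_comul_one (x : Option G) (α β : TYIdx G x) :
    ((1 : TYAlg D) ⊗ₜ[ℂ] tyF D x α β) * CoalgebraStruct.comul (R := ℂ) (1 : TYAlg D) =
      tySourceElt D (tyTgt x α) ⊗ₜ[ℂ] tyF D x α β := by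
  have h : ∀ η : Option G, ∑ δ : Option G, ∑ γ : Option G,
      tyF D (some 0) η γ ⊗ₜ[ℂ] (tyF D x α β * tyF D (some 0) γ δ) =
      tyF D (some 0) η (tyTgt x α) ⊗ₜ[ℂ] tyF D x α β := by
    intro η
    rw [Finset.sum_comm]
    simp only [← TensorProduct.tmul_sum, tyF_mul_sum_zero]
    rw [Finset.sum_eq_single (tyTgt x α) (fun γ _ hγ => by simp [hγ]) (by simp)]
    simp
  rw [tyComul_one]
  simp only [Finset.mul_sum, Algebra.TensorProduct.tmul_mul_tmul, one_mul, h, tySourceElt,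
    TensorProduct.sum_tmul]

theorem tyF_apply (x : Option G) (α β α' β' : TYIdx G x) :
    tyF D x α β x α' β' = if α = α' ∧ β = β' then 1 else 0 := by
  rw [tyF_eq, blockUnit_apply_apply]

theorem tyF_apply_ne {x y : Option G} (h : y ≠ x) (α β : TYIdx G x) (α' β' : TYIdx G y) :
    tyF D x α β y α' β' = 0 := by
  rw [tyF_eq, blockUnit_apply_ne h]
  rfl

/-- The coordinate `b ↦ b^x_{α,β}` with respect to the basis `f^x_{α,β}`. -/
noncomputable def tyCoord (x : Option G) (α β : TYIdx G x) : TYAlg D →ₗ[ℂ] ℂ where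
  toFun b := b x α β
  map_add' _ _ := rfl
  map_smul' _ _ := rfl

theorem ty_sum_apply {κ : Type*} (s : Finset κ) (c : κ → TYAlg D) (x : Option G)
    (α β : TYIdx G x) : (∑ i ∈ s, c i) x α β = ∑ i ∈ s, c i x α β :=
  map_sum (tyCoord D x α β) c s

/-- An element of `M ⊗ B` has unique coordinates in `M` with respect to the `f^x_{α,β}`. -/
theorem ty_sum_tmul_inj {M : Type*} [AddCommGroup M] [Module ℂ M]
    {c c' : ∀ x : Option G, TYIdx G x → TYIdx G x → M} :
    ∑ x, ∑ α, ∑ β, c x α β ⊗ₜ[ℂ] tyF D x α β = ∑ x, ∑ α, ∑ β, c' x α β ⊗ₜ[ℂ] tyF D x α β ↔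
      ∀ x α β, c x α β = c' x α β := by
  refine ⟨fun h x α β => ?_, fun h => by simp only [h]⟩
  -- The coordinate functional at `(x, α, β)`, applied to the second leg, recovers the coefficient.
  have key : ∀ c : ∀ x : Option G, TYIdx G x → TYIdx G x → M,
      TensorProduct.rid ℂ M (TensorProduct.map LinearMap.id (tyCoord D x α β)
        (∑ x, ∑ α, ∑ β, c x α β ⊗ₜ[ℂ] tyF D x α β)) = c x α β := by
    intro c
    simp only [map_sum, TensorProduct.map_tmul, TensorProduct.rid_tmul, LinearMap.id_apply]
    change ∑ y, ∑ γ, ∑ δ, (tyF D y γ δ x α β) • c y γ δ = c x α β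
    rw [Finset.sum_eq_single x]
    · simp [tyF_apply, ite_and]
    · intro y _ hy
      exact Finset.sum_eq_zero fun γ _ => Finset.sum_eq_zero fun δ _ => by
        rw [tyF_apply_ne D (Ne.symm hy), zero_smul]
    · simp
  rw [← key c, h, key c']

/-- The coideal of a quantum subgroupoid, in coordinates. -/
theorem mem_tyCoideal_iff (H : QuantumSubgroupoid (TYAlg D)) (b : TYAlg D) :
    b ∈ quotientTypeCoideal H ↔ ∀ (x : Option G) (γ β : TYIdx G x),
      ∑ α, b x α β • H.π.toStarAlgHom (tyF D x α γ) =
        b x γ β • H.π.toStarAlgHom (tySourceElt D (tyTgt x γ)) := by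
  -- Read backwards, the family of equations is one identity in `C ⊗ B`; it remains to see that its
  -- two sides are those of the defining equation.
  rw [← ty_sum_tmul_inj D]
  have h1 : TensorProduct.map H.π.toStarAlgHom.toAlgHom.toLinearMap LinearMap.id
      (Coalgebra.comul (R := ℂ) b) = ∑ x, ∑ γ, ∑ β,
        (∑ α, b x α β • H.π.toStarAlgHom (tyF D x α γ)) ⊗ₜ[ℂ] tyF D x γ β := by
    conv_lhs => rw [ty_sum D b]
    simp only [map_sum, map_smul, tyComul_tyF, TensorProduct.map_tmul, LinearMap.id_apply,
      TensorProduct.sum_tmul, ← TensorProduct.smul_tmul', Finset.smul_sum]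
    refine Finset.sum_congr rfl fun x _ => ?_
    -- The summation index `γ` produced by `Δ` becomes the row index of the second leg, and the
    -- original row `α` is summed inside.
    rw [Finset.sum_comm]
    conv_rhs => rw [Finset.sum_comm]
    refine Finset.sum_congr rfl fun β _ => ?_
    rw [Finset.sum_comm]
    rfl
  have h2 : TensorProduct.map H.π.toStarAlgHom.toAlgHom.toLinearMap LinearMap.id
      (((1 : TYAlg D) ⊗ₜ[ℂ] b) * Coalgebra.comul (R := ℂ) (1 : TYAlg D)) = ∑ x, ∑ γ, ∑ β,
        (b x γ β • H.π.toStarAlgHom (tySourceElt D (tyTgt x γ))) ⊗ₜ[ℂ] tyF D x γ β := by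
    conv_lhs => rw [ty_sum D b]
    simp only [TensorProduct.tmul_sum, TensorProduct.tmul_smul, Finset.sum_mul,
      smul_mul_assoc, map_sum, map_smul]
    refine Finset.sum_congr rfl fun x _ => Finset.sum_congr rfl fun γ _ =>
      Finset.sum_congr rfl fun β _ => ?_
    rw [← TensorProduct.smul_tmul']
    congr 1
    exact congrArg _ (tyF_tmul_comul_one D x γ β)
  rw [← h1, ← h2]
  rfl

/-! ### The source subalgebra and the coideal of the whole quantum groupoid -/

/-- On the basis, `ε_s` takes only the values `0` and `E_{t(α)}`, and every `E_σ` is attained, at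
`f^0_{σ,σ}`. -/
theorem sourceSubalgebra_eq_span :
    sourceSubalgebra (TYAlg D) = Submodule.span ℂ (Set.range (tySourceElt D)) := by
  refine le_antisymm ?_ (Submodule.span_le.2 ?_)
  · rintro _ ⟨b, rfl⟩
    rw [ty_sum D b]
    simp only [map_sum, map_smul, tySourceCounital_tyF]
    refine Submodule.sum_mem _ fun x _ => Submodule.sum_mem _ fun α _ =>
      Submodule.sum_mem _ fun β _ => Submodule.smul_mem _ _ ?_
    split_ifs
    · exact Submodule.subset_span ⟨_, rfl⟩
    · exact Submodule.zero_mem _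
  · rintro _ ⟨σ, rfl⟩
    exact ⟨tyF D (some 0) σ σ, by simp [tySourceCounital_tyF, tySourceElt, tyTgt]⟩

theorem tySourceElt_apply_zero (σ α β : Option G) :
    tySourceElt D σ (some 0) α β = if σ = β then 1 else 0 := by
  rw [tySourceElt, ty_sum_apply]
  simp [tyF_apply, ite_and]

theorem tySourceElt_apply_ne {x : Option G} (hx : x ≠ some 0) (σ : Option G) (α β : TYIdx G x) :
    tySourceElt D σ x α β = 0 := by
  rw [tySourceElt, ty_sum_apply]
  exact Finset.sum_eq_zero fun η _ => tyF_apply_ne D hx η σ α β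

/-- With `π = id` the coordinate equations compare linearly independent elements. They force `b`
into block `0` and make each of its columns constant there, which is what membership in the span of
the `E_σ` means. -/
theorem tyCoideal_self :
    quotientTypeCoideal (QuantumSubgroupoid.self (TYAlg D)) = sourceSubalgebra (TYAlg D) := by
  rw [sourceSubalgebra_eq_span]
  ext b
  rw [mem_tyCoideal_iff]
  constructor
  · intro h
    -- Coefficient of `f^x_{α,γ}` in the equation attached to `(x, γ, β)`; on the left only the term
    -- with row `α` contributes.
    have h' : ∀ (x : Option G) (α γ β : TYIdx G x),
        b x α β = b x γ β * tySourceElt D (tyTgt x γ) x α γ := by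
      intro x α γ β
      have hx : ∑ η, b x η β • tyF D x η γ = b x γ β • tySourceElt D (tyTgt x γ) := h x γ β
      have := congrArg (tyCoord D x α γ) hx
      rw [map_sum] at this
      change ∑ η, b x η β * tyF D x η γ x α γ = b x γ β * _ at this
      simpa [tyF_apply] using this
    -- Every `E_σ` lives in block `0`, so in any other block the right-hand side vanishes.
    have hne : ∀ x, x ≠ some 0 → ∀ α β, b x α β = 0 := fun x hx α β => by
      rw [h' x α α β, tySourceElt_apply_ne D hx, mul_zero]
    -- In block `0` the target of `γ` is `γ` itself, and `E_γ` has coefficient `1` at `(α, γ)` for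
    -- every `α`.
    have hz : ∀ α γ β, b (some 0) α β = b (some 0) γ β := fun α γ β => by
      rw [h' (some 0) α γ β, tySourceElt_apply_zero]
      simp [tyTgt]
    -- Columns are constant, so any row can serve as reference; row `m` is used.
    have hb : b = ∑ β : Option G, b (some 0) none β • tySourceElt D β := by
      conv_lhs => rw [ty_sum D b]
      rw [Finset.sum_eq_single (some 0)
        (fun x _ hx => Finset.sum_eq_zero fun α _ => Finset.sum_eq_zero fun β _ => by
          rw [hne x hx, zero_smul]) (by simp), Finset.sum_comm]
      refine Finset.sum_congr rfl fun β _ => ?_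
      rw [tySourceElt, Finset.smul_sum]
      exact Finset.sum_congr rfl fun α _ => by rw [hz α none β]
    rw [hb]
    exact Submodule.sum_mem _ fun β _ => Submodule.smul_mem _ _ (Submodule.subset_span ⟨β, rfl⟩)
  · intro hb
    -- The coideal is a subspace, so it is enough to test the generators `E_σ`.
    rw [← mem_tyCoideal_iff]
    refine (Submodule.span_le (p := quotientTypeCoideal _)).2 ?_ hb
    rintro _ ⟨σ, rfl⟩
    rw [SetLike.mem_coe, mem_tyCoideal_iff]
    intro x γ β
    suffices ∑ α, tySourceElt D σ x α β • tyF D x α γ =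
        tySourceElt D σ x γ β • tySourceElt D (tyTgt x γ) from this
    by_cases hx : x = some 0
    · subst hx
      -- The coefficient `δ_{σ,β}` does not depend on the row, so it leaves the sum; the remaining
      -- sum of the `f^0_{α,γ}` over `α` is `E_γ` by definition, and `t(γ) = γ`.
      simp only [tySourceElt_apply_zero, ← Finset.smul_sum]
      rfl
    · simp [tySourceElt_apply_ne D hx]

/-! ### The equations of the coideal of a subgroup -/

variable (L : AddSubgroup G)

theorem tySubE0_apply (d : G) (y z i j : Option G) (l : L) :
    tySubE0 D L d y z l i j = if d = l ∧ y = i ∧ z = j then 1 else 0 := by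
  rw [← tyE_restrict]
  by_cases h : d = l
  · subst h
    refine (blockUnit_apply_apply (n := TYIdx G) (some (l : G)) y z i j).trans ?_
    simp
  · rw [if_neg (fun h' => h h'.1)]
    have h' : (some (l : G)) ≠ some d := by simpa using Ne.symm h
    exact congrFun (congrFun (blockUnit_apply_ne (n := TYIdx G) h' y z) i) j

theorem tySubE0_of_notMem {d : G} (h : d ∉ L) (y z : Option G) : tySubE0 D L d y z = 0 := by
  simp [tySubE0, h]

/-- Coordinates on `B_L`. -/
noncomputable def tySubCoord (l : L) (i j : Option G) : TYSub D L →ₗ[ℂ] ℂ where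
  toFun b := b l i j
  map_add' _ _ := rfl
  map_smul' _ _ := rfl

theorem tySubCoord_E0 (d : G) (y z i j : Option G) (l : L) :
    tySubCoord D L l i j (tySubE0 D L d y z) = if d = l ∧ y = i ∧ z = j then 1 else 0 :=
  tySubE0_apply D L d y z i j l

/-- The term `f^0_{m,k}` of `E_k` lies in the block `B(H^m)`, which `π_L` kills, and `f^0_{h,k}`
becomes the diagonal unit `e^{h-k}_{-k,-k}`. Only the `h` in the coset of `k` really contribute. -/
theorem tyProj_sourceElt_some (k : G) : tyProj D L (tySourceElt D (some k)) =
    ∑ h : G, tySubE0 D L (h - k) (some (-k)) (some (-k)) := by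
  rw [tySourceElt, map_sum]
  simp only [tyProj_tyF, Fintype.sum_option, tyProjF, zero_add, zero_sub]

/-- Only `f^0_{m,m}` survives `π_L`, and its coefficients `χ(0, d)` all equal `1`. Comparison with
the coefficients `χ(g, d)` of `f^g_{m,m}` is what brings in `L^⊥`. -/
theorem tyProj_sourceElt_none : tyProj D L (tySourceElt D none) =
    ∑ d : G, tySubE0 D L d none none := by
  rw [tySourceElt, map_sum]
  simp [tyProj_tyF, Fintype.sum_option, tyProjF, D.χ_zero_left]

/-- The coideal `I^L`, in coordinates. -/
theorem mem_tyCoideal_sub_iff (b : TYAlg D) :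
    b ∈ quotientTypeCoideal (tySubgroupoid D L) ↔
      (∀ α β, b none α β = 0) ∧
      (∀ g k β, g ≠ 0 → b (some g) (some k) β = 0) ∧
      (∀ g β, g ∉ tyPerp D L → b (some g) none β = 0) ∧
      ∀ h k β, h - k ∈ L → b (some 0) (some h) β = b (some 0) (some k) β := by
  rw [mem_tyCoideal_iff]
  change (∀ (x : Option G) (γ β : TYIdx G x), ∑ α, b x α β • tyProj D L (tyF D x α γ) =
    b x γ β • tyProj D L (tySourceElt D (tyTgt x γ))) ↔ _
  simp only [tyProj_tyF]
  constructor
  · intro H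
    refine ⟨?_, ?_, ?_, ?_⟩
    · rintro (k | k) β
      -- The left-hand side is `∑ h, b^m_{h,β} e^{h-k}_{-k,m}`; at the unit `e^0_{-k,m}` only `h =
      -- k` is seen, while the right-hand side consists of units at position `(m, m)`.
      · have := congrArg (tySubCoord D L 0 (some (-k)) none) (H none (Sum.inl k) β)
        simpa [Fintype.sum_sum_type, tyProjF, tyTgt, tyProj_sourceElt_none, tySubCoord_E0,
          sub_eq_zero] using this
      -- Same comparison for the barred rows: the units on the left have position `(m, -k)`, those
      -- on the right `(-k, -k)`.
      · have := congrArg (tySubCoord D L 0 none (some (-k))) (H none (Sum.inr k) β)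
        simpa [Fintype.sum_sum_type, tyProjF, tyTgt, tyProj_sourceElt_some, tySubCoord_E0,
          sub_eq_zero] using this
    · intro g k β hg
      -- On the left all units have row `g - k ≠ -k`, so this coordinate is zero there; on the right
      -- it is `b^g_{k,β}`.
      have := congrArg (tySubCoord D L 0 (some (-k)) (some (-k))) (H (some g) (some k) β)
      simpa [Fintype.sum_option, tyProjF, tyTgt, tyProj_sourceElt_some, tySubCoord_E0,
        sub_eq_zero, sub_eq_add_neg g, hg] using this.symm
    · intro g β hg
      -- An `l ∈ L` with `χ(g, l) ≠ 1` gives, at the unit `e^l_{m,m}`, the relation `b χ(g, l) = b`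
      -- for the coordinate `b` in question, hence `b = 0`.
      obtain ⟨l, hl, hgl⟩ : ∃ l ∈ L, D.χ g l ≠ 1 := by simpa [tyPerp] using hg
      have := congrArg (tySubCoord D L ⟨l, hl⟩ none none) (H (some g) none β)
      have h1 : b (some g) none β * (D.χ g l : ℂ) = b (some g) none β := by
        simpa [Fintype.sum_option, tyProjF, tyTgt, tyProj_sourceElt_none, tySubCoord_E0]
          using this
      by_contra h0
      exact hgl (Circle.ext (mul_left_cancel₀ h0 (by simpa using h1)))
    · intro h k β hL
      -- At block `h - k` of `B_L` the left-hand side contributes only `b^0_{h,β}` and the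
      -- right-hand side only `b^0_{k,β}`. If `h - k ∉ L` there is no such block and hence no
      -- constraint.
      have := congrArg (tySubCoord D L ⟨h - k, hL⟩ (some (-k)) (some (-k)))
        (H (some 0) (some k) β)
      simpa [Fintype.sum_option, tyProjF, tyTgt, tyProj_sourceElt_some, tySubCoord_E0] using this
  · rintro ⟨h1, h2, h3, h4⟩ (_ | g) γ β
    · simp [h1]
    · rcases γ with _ | k
      · simp only [Fintype.sum_option, tyProjF, tyTgt, tyProj_sourceElt_none, smul_zero,
          Finset.sum_const_zero, add_zero]
        by_cases hg : g ∈ tyPerp D L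
        · congr 1
          refine Finset.sum_congr rfl fun d _ => ?_
          -- The coefficients `χ(g, d)` and `1` are known to agree only for `d ∈ L`; the other units
          -- are zero in `B_L`.
          by_cases hd : d ∈ L
          · rw [hg d hd]; simp
          · simp [tySubE0_of_notMem D L hd]
        · rw [h3 g β hg, zero_smul, zero_smul]
      · simp only [Fintype.sum_option, tyProjF, tyTgt, tyProj_sourceElt_some, smul_zero, zero_add]
        by_cases hg : g = 0
        · subst hg
          rw [Finset.smul_sum]
          refine Finset.sum_congr rfl fun h _ => ?_
          -- Termwise comparison: within a coset the coefficients agree, and outside it the unit is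
          -- zero.
          by_cases hd : h - k ∈ L
          · rw [h4 h k β hd, zero_sub]
          · simp [tySubE0_of_notMem D L hd]
        · simp [h2 g _ β hg]

/-! ### The summands in coordinates -/

theorem tyTens_single_apply (x : Option G) (v w : TYIdx G x → ℂ) (α β : TYIdx G x) :
    tyTens D (Pi.single x v) (Pi.single x w) x α β = v α * star (w β) := by
  simp [tyTens, Matrix.vecMulVec_apply]

theorem tyTens_single_apply_ne {x y : Option G} (h : y ≠ x) (v w : TYIdx G x → ℂ)
    (α β : TYIdx G y) : tyTens D (Pi.single x v) (Pi.single x w) y α β = 0 := by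
  simp [tyTens, Matrix.vecMulVec_apply, h]

/-- An element of `H^x ⊗ H̄^x` expands uniquely along the orthonormal basis of the second factor,
and its coefficient at `v̄^x_β` is its column `β`. Hence lying in `X ⊗ H̄^x` is a condition on each
column separately, the same form as the equations of the coideal. -/
theorem mem_tyTensSub_iff (x : Option G) (X : Submodule ℂ (TYIdx G x → ℂ)) (b : TYAlg D) :
    b ∈ tyTensSub D x X ↔
      (∀ y, y ≠ x → ∀ α β, b y α β = 0) ∧ ∀ β, (fun α => b x α β) ∈ X := by
  constructor
  · intro hb
    refine Submodule.span_induction (p := fun b _ => (∀ y, y ≠ x → ∀ α β, b y α β = 0) ∧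
      ∀ β, (fun α => b x α β) ∈ X) ?_ ?_ ?_ ?_ hb
    · rintro _ ⟨v, hv, w, rfl⟩
      refine ⟨fun y hy α β => tyTens_single_apply_ne D hy v w α β, fun β => ?_⟩
      -- Column `β` of `v ⊗ w̄` is the multiple of `v` by the conjugate of `w_β`.
      convert X.smul_mem (star (w β)) hv using 1
      funext α
      rw [tyTens_single_apply, Pi.smul_apply, smul_eq_mul, mul_comm]
    · exact ⟨fun _ _ _ _ => rfl, fun _ => X.zero_mem⟩
    · intro a c _ _ ha hc
      refine ⟨fun y hy α β => ?_, fun β => X.add_mem (ha.2 β) (hc.2 β)⟩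
      change a y α β + c y α β = 0
      rw [ha.1 y hy, hc.1 y hy, add_zero]
    · intro r a _ ha
      refine ⟨fun y hy α β => ?_, fun β => X.smul_mem r (ha.2 β)⟩
      change r * a y α β = 0
      rw [ha.1 y hy, mul_zero]
  · rintro ⟨h1, h2⟩
    -- The expansion of `b` along the second factor: column `β` tensored with the conjugate of the
    -- basis vector `v^x_β`.
    have hb : b = ∑ β, tyTens D (Pi.single x fun α => b x α β) (Pi.single x (Pi.single β 1)) := by
      funext y
      ext α β
      refine Eq.trans ?_ (ty_sum_apply D _ _ y α β).symm
      by_cases hy : y = x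
      · subst hy
        simp [tyTens_single_apply, Pi.single_apply, apply_ite]
      · rw [h1 y hy]
        exact (Finset.sum_eq_zero fun δ _ => tyTens_single_apply_ne D hy _ _ α β).symm
    rw [hb]
    exact Submodule.sum_mem _ fun β _ => Submodule.subset_span ⟨_, h2 β, _, rfl⟩

theorem tyCosetVec_apply_none (Y : G ⧸ L) : tyCosetVec L Y none = 0 := by
  rw [tyCosetVec, Finset.sum_apply]
  exact Finset.sum_eq_zero fun y _ => by split_ifs <;> simp

open Classical in
theorem tyCosetVec_apply_some (Y : G ⧸ L) (k : G) :
    tyCosetVec L Y (some k) = if (QuotientAddGroup.mk k : G ⧸ L) = Y then 1 else 0 := by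
  rw [tyCosetVec, Finset.sum_apply, Finset.sum_eq_single k]
  · split_ifs <;> simp
  · intro y _ hy
    split_ifs
    · exact Pi.single_eq_of_ne (by simpa using Ne.symm hy) _
    · rfl
  · simp

/-- The `v^0_Y` are the indicator functions of the cosets of `L`, extended by `0` at `m`; a function
on `G` is a combination of them exactly when it is constant on cosets. -/
theorem mem_span_tyCosetVec_iff (v : TYIdx G (some 0) → ℂ) :
    v ∈ Submodule.span ℂ (Set.range (tyCosetVec L)) ↔
      v none = 0 ∧ ∀ h k : G, h - k ∈ L → v (some h) = v (some k) := by
  classical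
  constructor
  · intro hv
    refine Submodule.span_induction (p := fun v _ => v none = 0 ∧
      ∀ h k : G, h - k ∈ L → v (some h) = v (some k)) ?_ ?_ ?_ ?_ hv
    · rintro _ ⟨Y, rfl⟩
      refine ⟨tyCosetVec_apply_none L Y, fun h k hL => ?_⟩
      have : (QuotientAddGroup.mk h : G ⧸ L) = QuotientAddGroup.mk k :=
        QuotientAddGroup.eq_iff_sub_mem.2 hL
      rw [tyCosetVec_apply_some, tyCosetVec_apply_some, this]
    · exact ⟨rfl, fun _ _ _ => rfl⟩
    · intro a c _ _ ha hc
      exact ⟨by simp [ha.1, hc.1], fun h k hL => by simp [ha.2 h k hL, hc.2 h k hL]⟩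
    · intro r a _ ha
      exact ⟨by simp [ha.1], fun h k hL => by simp [ha.2 h k hL]⟩
  · rintro ⟨h0, h1⟩
    -- The coefficient of `v^0_Y` is the value of `v` at a chosen representative of `Y`; the choice
    -- is immaterial by invariance.
    have hv : v = ∑ Y : G ⧸ L, v (some Y.out) • tyCosetVec L Y := by
      funext α
      rw [Finset.sum_apply]
      rcases α with _ | k
      · simp [h0, tyCosetVec_apply_none]
      · simp only [Pi.smul_apply, tyCosetVec_apply_some, smul_eq_mul, mul_ite, mul_one, mul_zero,
          Finset.sum_ite_eq, Finset.mem_univ, if_true]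
        exact h1 _ _ (QuotientAddGroup.eq_iff_sub_mem.1 (QuotientAddGroup.out_eq' _).symm)
    rw [hv]
    exact Submodule.sum_mem _ fun Y _ => Submodule.smul_mem _ _ (Submodule.subset_span ⟨Y, rfl⟩)

theorem mem_span_tyVecM_iff (g : G) (v : TYIdx G (some g) → ℂ) :
    v ∈ Submodule.span ℂ {tyVecM g} ↔ ∀ k : G, v (some k) = 0 := by
  rw [Submodule.mem_span_singleton]
  constructor
  · rintro ⟨r, rfl⟩ k
    simp [tyVecM]
  · intro h
    refine ⟨v none, ?_⟩
    funext α
    rcases α with _ | k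
    · simp [tyVecM]
    · simp [tyVecM, h]

/-- Obtained column by column. The vanishing of row `m` is what separates this summand from `v^0_m ⊗
H̄^0`, which lies in the same block. -/
theorem mem_tySummand_none_iff (b : TYAlg D) : b ∈ tySummand D L none ↔
    (∀ y, y ≠ some 0 → ∀ α β, b y α β = 0) ∧ (∀ β, b (some 0) none β = 0) ∧
      ∀ h k β, h - k ∈ L → b (some 0) (some h) β = b (some 0) (some k) β := by
  refine (mem_tyTensSub_iff D _ _ b).trans (and_congr_right fun _ =>
    (forall_congr' fun β => mem_span_tyCosetVec_iff L _).trans ?_)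
  exact forall_and.trans (and_congr_right fun _ =>
    ⟨fun h i k β => h β i k, fun h β i k => h i k β⟩)

theorem mem_tySummand_some_iff (l : tyPerp D L) (b : TYAlg D) : b ∈ tySummand D L (some l) ↔
    (∀ y, y ≠ some (l : G) → ∀ α β, b y α β = 0) ∧ ∀ k β, b (some (l : G)) (some k) β = 0 := by
  refine (mem_tyTensSub_iff D _ _ b).trans (and_congr_right fun _ =>
    (forall_congr' fun β => mem_span_tyVecM_iff _ _).trans forall_comm)

/-! ### Independence of the summands -/

/-- The span of the basis elements `f^x_{α,β}` with `(x, α)` in a given set. -/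
def tySupported (A : Set (Σ x : Option G, TYIdx G x)) : Submodule ℂ (TYAlg D) where
  carrier := {b | ∀ x α β, (⟨x, α⟩ : Σ x : Option G, TYIdx G x) ∉ A → b x α β = 0}
  zero_mem' := fun _ _ _ _ => rfl
  add_mem' {a c} ha hc x α β h := by
    change a x α β + c x α β = 0
    rw [ha x α β h, hc x α β h, add_zero]
  smul_mem' r a ha x α β h := by
    change r * a x α β = 0
    rw [ha x α β h, mul_zero]

/-- All summands other than the `i`-th are supported off `A i`, hence so is their supremum. An
element of both has no row left in which it could be nonzero. -/
theorem iSupIndep_of_le_tySupported {κ : Type*} {S : κ → Submodule ℂ (TYAlg D)}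
    (A : κ → Set (Σ x : Option G, TYIdx G x)) (hA : Pairwise fun i j => Disjoint (A i) (A j))
    (hS : ∀ i, S i ≤ tySupported D (A i)) : iSupIndep S := by
  intro i
  rw [Submodule.disjoint_def]
  intro b hb hb'
  have hle : ⨆ j, ⨆ _ : j ≠ i, S j ≤ tySupported D (A i)ᶜ :=
    iSup₂_le fun j hj c hc x α β h =>
      hS j hc x α β (Set.disjoint_left.1 (hA hj.symm) (not_not.1 h))
  funext x
  ext α β
  by_cases h : (⟨x, α⟩ : Σ x : Option G, TYIdx G x) ∈ A i
  · exact hle hb' x α β (not_not.2 h)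
  · exact hS i hb x α β h

/-- The indices `(x, α)` that occur in the summands of `I^L`. -/
def tySummandSupport : Option (tyPerp D L) → Set (Σ x : Option G, TYIdx G x)
  | none => {p | ∃ k : G, p = ⟨some 0, some k⟩}
  | some l => {⟨some (l : G), none⟩}

/-- Summands in different blocks clearly have disjoint supports. The only two sharing a block are
the coset summand and the one for `l = 0`, both in block `0`; the former uses the rows in `G`, the
latter the row `m`. -/
theorem tySummand_indep : iSupIndep (tySummand D L) := by
  refine iSupIndep_of_le_tySupported D (tySummandSupport D L) ?_ ?_
  · rintro (_ | l) (_ | l') h <;> rw [Set.disjoint_left]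
    · exact absurd rfl h
    · rintro _ ⟨k, rfl⟩ h'
      have h' := Set.mem_singleton_iff.1 h'
      rw [Sigma.mk.injEq] at h'
      obtain ⟨h1, h2⟩ := h'
      -- A common index would have row `k ∈ G` and row `m` at once.
      have h2 : (some k : Option G) = none := eq_of_heq h2
      cases h2
    · rintro _ h' ⟨k, rfl⟩
      have h' := Set.mem_singleton_iff.1 h'
      rw [Sigma.mk.injEq] at h'
      obtain ⟨h1, h2⟩ := h'
      have h2 : (some k : Option G) = none := eq_of_heq h2
      cases h2
    · rintro _ rfl h'
      have h' := Set.mem_singleton_iff.1 h'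
      rw [Sigma.mk.injEq] at h'
      exact h (congrArg some (Subtype.ext (Option.some.inj h'.1)))
  · rintro (_ | l) b hb x α β hx
    · rw [mem_tySummand_none_iff] at hb
      by_cases h : x = some 0
      · subst h
        rcases α with _ | k
        · exact hb.2.1 β
        · exact absurd ⟨k, rfl⟩ hx
      · exact hb.1 x h α β
    · rw [mem_tySummand_some_iff] at hb
      by_cases h : x = some (l : G)
      · subst h
        rcases α with _ | k
        · exact absurd rfl hx
        · exact hb.2 k β
      · exact hb.1 x h α β

/-! ### The coideal of a subgroup as the sum of the summands -/

theorem tySummand_le_tyCoideal (i : Option (tyPerp D L)) :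
    tySummand D L i ≤ quotientTypeCoideal (tySubgroupoid D L) := by
  intro b hb
  rw [mem_tyCoideal_sub_iff]
  rcases i with _ | l
  · rw [mem_tySummand_none_iff] at hb
    obtain ⟨h1, h2, h3⟩ := hb
    refine ⟨h1 none (by simp), fun g k β hg => h1 (some g) (by simpa using hg) _ _,
      fun g β hg => ?_, h3⟩
    -- Row `m` of the coset summand vanishes in every block: in block `0` because the `v^0_Y` have
    -- no component at `m`, elsewhere because of the block.
    by_cases h : g = 0
    · subst h; exact h2 β
    · exact h1 (some g) (by simpa using h) _ _
  · rw [mem_tySummand_some_iff] at hb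
    obtain ⟨h1, h2⟩ := hb
    have h3 : ∀ g k β, b (some g) (some k) β = 0 := by
      intro g k β
      by_cases h : g = l
      · subst h; exact h2 k β
      · exact h1 (some g) (by simpa using h) _ _
    refine ⟨h1 none (by simp), fun g k β _ => h3 g k β, fun g β hg => ?_,
      fun h k β _ => by rw [h3, h3]⟩
    -- Row `m` can be nonzero only in block `l`, and `l ∈ L^⊥` whereas `g ∉ L^⊥`.
    refine h1 (some g) (fun h => hg ?_) _ _
    rw [Option.some.inj h]
    exact l.2

/-- The equations leave only two kinds of rows in `b`. Row `m` of block `g` lies in the summand of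
`g` if `g ∈ L^⊥` and is zero otherwise; the rows of block `0` indexed by `G` lie, taken together, in
the coset summand. -/
theorem tyCoideal_le_iSup_tySummand :
    quotientTypeCoideal (tySubgroupoid D L) ≤ ⨆ i, tySummand D L i := by
  classical
  intro b hb
  rw [mem_tyCoideal_sub_iff] at hb
  obtain ⟨h1, h2, h3, h4⟩ := hb
  have hF : ∀ g β, b (some g) none β • tyF D (some g) none β ∈ ⨆ i, tySummand D L i := by
    intro g β
    by_cases hg : g ∈ tyPerp D L
    · refine Submodule.smul_mem _ _ (Submodule.mem_iSup_of_mem (some ⟨g, hg⟩) ?_)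
      -- The basis element `f^g_{m,β}` is by definition the elementary tensor of `v^g_m` with the
      -- conjugate of `v^g_β`.
      exact Submodule.subset_span ⟨tyVecM g, Submodule.subset_span rfl, Pi.single β 1, rfl⟩
    · rw [h3 g β hg, zero_smul]
      exact Submodule.zero_mem _
  -- A single row `k` is in general not in the coset summand, since invariance relates different
  -- rows. The rows are therefore kept together and the sum is split by columns instead.
  have hC : ∑ k : G, ∑ β : Option G, b (some 0) (some k) β • tyF D (some 0) (some k) β ∈
      ⨆ i, tySummand D L i := by
    refine Submodule.mem_iSup_of_mem none ?_
    rw [Finset.sum_comm]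
    refine Submodule.sum_mem _ fun β _ => Submodule.subset_span
      -- The first tensor factor is column `β` of block `0` with its entry at `m` replaced by `0`;
      -- that entry belongs to the summand of `l = 0`.
      ⟨fun α => α.elim 0 fun k => b (some 0) (some k) β,
        (mem_span_tyCosetVec_iff L _).2 ⟨rfl, fun h k hL => h4 h k β hL⟩, Pi.single β 1, ?_⟩
    have hv : (Pi.single (some (0 : G))
        (fun α : Option G => α.elim 0 fun k => b (some 0) (some k) β) :
          ∀ x : Option G, TYIdx G x → ℂ) =
        ∑ k : G, b (some 0) (some k) β • tyVec (some 0) (some k) := by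
      rw [tyVec_sum (Pi.single _ _), Finset.sum_eq_single (some 0)
        (fun y _ hy => Finset.sum_eq_zero fun κ _ => by simp [hy]) (by simp)]
      simp only [Pi.single_eq_same]
      refine (Fintype.sum_option _).trans ?_
      simp
    rw [hv, tyTens_sum_left]
    simp only [tyTens_smul_left]
    rfl
  -- Block `m` is split off and vanishes; in each block `g` the row `m` is then separated from the
  -- rows in `G`.
  rw [ty_sum D b, Fintype.sum_option]
  refine Submodule.add_mem _ ?_ ?_
  · simp [h1]
  · have : ∀ g : G, ∑ α : Option G, ∑ β : Option G, b (some g) α β • tyF D (some g) α β ∈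
        ⨆ i, tySummand D L i := by
      intro g
      rw [Fintype.sum_option]
      refine Submodule.add_mem _ (Submodule.sum_mem _ fun β _ => hF g β) ?_
      by_cases hg : g = 0
      · subst hg; exact hC
      · simp [h2 g _ _ hg]
    exact Submodule.sum_mem _ fun g _ => this g

end TYCoideals

/-- The direct sum is expressed by independence of the family of summands together with equality of
the coideal and their supremum. -/
theorem proposition5p4 {G : Type u} [AddCommGroup G] [Fintype G] [DecidableEq G] (D : TYData G) :
    quotientTypeCoideal (QuantumSubgroupoid.self (TYAlg D)) = sourceSubalgebra (TYAlg D) ∧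
    ∀ L : AddSubgroup G,
      iSupIndep (tySummand D L) ∧
      quotientTypeCoideal (tySubgroupoid D L) = ⨆ i, tySummand D L i :=
  ⟨tyCoideal_self D, fun L => ⟨tySummand_indep D L,
    le_antisymm (tyCoideal_le_iSup_tySummand D L) (iSup_le (tySummand_le_tyCoideal D L))⟩⟩
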